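/- Let $k \ge 1$ be an integer and let $N = \mathbb{C}^k$ with coordinates $\sigma_1, \dots, \sigma_k$, partial derivatives $\partial_1, \dots, \partial_k$, sheaf of holomorphic functions $\mathcal{O}_N$, sheaf of holomorphic $1$-forms $\Omega^1_N$ and sheaf of holomorphic differential operators $\mathcal{D}_N$. Put $E = \sum_{h=1}^k \sigma_h \partial_h$ and $U_0 = \sum_{h=1}^k h\,\sigma_h \partial_h$, and let $\Delta(\sigma)$ be the discriminant of $P_\sigma(z) = z^k + \sum_{h=1}^k (-1)^h \sigma_h z^{k-h}$. For $\mu, \lambda \in \mathbb{C}$ let $\mathcal{I}_\mu \subset \mathcal{D}_N$ be the left ideal generated by $\partial_i \partial_j - \partial_{i+1}\partial_{j-1}$ ($1 \le i \le k-1$, $2 \le j \le k$) and by $\partial_1 \partial_{m-1} + \partial_m (E + \mu)$ ($2 \le m \le k$), and let $\mathcal{N}_{\mu,\lambda} = \mathcal{D}_N / \big(\mathcal{I}_\mu + \mathcal{D}_N (U_0 - \lambda)\big)$. Let $\mu \in \mathbb{C}$ and $\lambda \in \mathbb{C} \setminus \mathbb{N}$, where $0 \in \mathbb{N}$. Then there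 exists an integrable meromorphic connection $$\nabla_{\mu,\lambda} : \mathcal{O}_N^k \to \tfrac{1}{\sigma_k \Delta}\, \mathcal{O}_N^k \otimes \Omega^1_N$$ (so with at most a simple pole along the reduced hypersurface $\{\sigma_k \Delta(\sigma) = 0\}$) such that the restriction of $\mathcal{N}_{\mu,\lambda}$ to the open set $U = \{\sigma_k \Delta(\sigma) \ne 0\}$ is isomorphic to the $\mathcal{D}_U$-module defined by $(\mathcal{O}_N^k, \nabla_{\mu,\lambda})$. Moreover, this isomorphism is the restriction to $U$ of an injective $\mathcal{D}_N$-linear map $$\mathcal{N}_{\mu,\lambda} \to \big(\mathcal{O}_N^k(*\sigma_k\Delta), \nabla_{\mu,\lambda}\big).$$ In particular $\mathcal{N}_{\mu,\lambda}$ has no $\mathcal{O}_N$-torsion: if $f \ne 0$ is a germ of holomorphic function at a point of $N$ and $n$ is a germ of section of $\mathcal{N}_{\mu,\lambda}$ there with $f n = 0$, then $n = 0$. -/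

import Mathlib

noncomputable section

open scoped Topology

namespace TraceSystem

/-- Functions on `N = ℂ^k` that are holomorphic in a neighbourhood of `x`. -/
def holAt {k : ℕ} (x : Fin k → ℂ) : Subalgebra ℂ ((Fin k → ℂ) → ℂ) where
  carrier := {f | AnalyticAt ℂ f x}
  mul_mem' := fun hf hg => AnalyticAt.mul hf hg
  add_mem' := fun hf hg => AnalyticAt.add hf hg
  algebraMap_mem' := fun _ => analyticAt_const

/-- The ideal of the functions that vanish near `x`. -/
def nullAt {k : ℕ} (x : Fin k → ℂ) : Ideal (holAt x) where
  carrier := {f | ∀ᶠ y in 𝓝 x, f.1 y = 0}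
  add_mem' := by
    intro a b ha hb
    filter_upwards [ha, hb] with y h1 h2
    change a.1 y + b.1 y = 0
    rw [h1, h2, add_zero]
  zero_mem' := Filter.Eventually.of_forall fun _ => rfl
  smul_mem' := by
    intro c a ha
    filter_upwards [ha] with y h1
    change c.1 y * a.1 y = 0
    rw [h1, mul_zero]

/-- The stalk `𝒪_{N,x}`: germs at `x` of holomorphic functions. -/
def Stalk {k : ℕ} (x : Fin k → ℂ) : Type := holAt x ⧸ nullAt x

instance {k : ℕ} (x : Fin k → ℂ) : CommRing (Stalk x) :=
  inferInstanceAs (CommRing (holAt x ⧸ nullAt x))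

instance {k : ℕ} (x : Fin k → ℂ) : Algebra ℂ (Stalk x) :=
  inferInstanceAs (Algebra ℂ (holAt x ⧸ nullAt x))

/-- The quotient map to germs. -/
def toStalk {k : ℕ} (x : Fin k → ℂ) : holAt x →ₐ[ℂ] Stalk x := Ideal.Quotient.mkₐ ℂ (nullAt x)

theorem toStalk_surjective {k : ℕ} (x : Fin k → ℂ) : Function.Surjective (toStalk x) :=
  Ideal.Quotient.mk_surjective

theorem toStalk_eq_iff {k : ℕ} (x : Fin k → ℂ) (f g : holAt x) :
    toStalk x f = toStalk x g ↔ f.1 =ᶠ[𝓝 x] g.1 := by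
  refine Ideal.Quotient.eq.trans ?_
  change (∀ᶠ y in 𝓝 x, f.1 y - g.1 y = 0) ↔ _
  simp only [sub_eq_zero]
  rfl

open Classical in
/-- The germ at `x` of a function holomorphic near `x` (and `0` for any other function). -/
def germ {k : ℕ} (x : Fin k → ℂ) (f : (Fin k → ℂ) → ℂ) : Stalk x :=
  if hf : AnalyticAt ℂ f x then toStalk x ⟨f, hf⟩ else 0

theorem germ_of_mem {k : ℕ} {x : Fin k → ℂ} (f : holAt x) :
    germ x f.1 = toStalk x f :=
  dif_pos f.2

/-- The partial derivative of a function in the direction of the `p`-th coordinate. -/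
def pderivFun {k : ℕ} (p : Fin k) (f : (Fin k → ℂ) → ℂ) : (Fin k → ℂ) → ℂ :=
  fun y => fderiv ℂ f y (Pi.single p 1)

theorem analyticAt_pderivFun {k : ℕ} (p : Fin k) {x : Fin k → ℂ} {f : (Fin k → ℂ) → ℂ}
    (hf : AnalyticAt ℂ f x) : AnalyticAt ℂ (pderivFun p f) x :=
  ((ContinuousLinearMap.apply ℂ ℂ (Pi.single p 1 : Fin k → ℂ)).analyticAt _).comp hf.fderiv

theorem germ_eq_of_eventuallyEq {k : ℕ} {x : Fin k → ℂ} {f g : (Fin k → ℂ) → ℂ}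
    (hf : AnalyticAt ℂ f x) (h : f =ᶠ[𝓝 x] g) : germ x f = germ x g := by
  have hg : AnalyticAt ℂ g x := hf.congr h
  rw [germ, germ, dif_pos hf, dif_pos hg, toStalk_eq_iff]
  exact h

theorem germ_add {k : ℕ} {x : Fin k → ℂ} {f g : (Fin k → ℂ) → ℂ}
    (hf : AnalyticAt ℂ f x) (hg : AnalyticAt ℂ g x) :
    germ x (f + g) = germ x f + germ x g := by
  rw [germ, germ, germ, dif_pos hf, dif_pos hg, dif_pos (hf.add hg)]
  rfl

theorem germ_mul {k : ℕ} {x : Fin k → ℂ} {f g : (Fin k → ℂ) → ℂ}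
    (hf : AnalyticAt ℂ f x) (hg : AnalyticAt ℂ g x) :
    germ x (f * g) = germ x f * germ x g := by
  rw [germ, germ, germ, dif_pos hf, dif_pos hg, dif_pos (hf.mul hg)]
  rfl

theorem germ_smul {k : ℕ} {x : Fin k → ℂ} {f : (Fin k → ℂ) → ℂ} (c : ℂ)
    (hf : AnalyticAt ℂ f x) : germ x (c • f) = c • germ x f := by
  rw [germ, germ, dif_pos hf, dif_pos (hf.const_smul (c := c))]
  rfl

/-- Partial derivative from functions holomorphic near `x` to germs at `x`. -/
def pderivPre {k : ℕ} (x : Fin k → ℂ) (p : Fin k) : holAt x →ₗ[ℂ] Stalk x where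
  toFun f := germ x (pderivFun p f.1)
  map_add' f g := by
    rw [← germ_add (analyticAt_pderivFun p f.2) (analyticAt_pderivFun p g.2)]
    refine germ_eq_of_eventuallyEq (analyticAt_pderivFun p (f + g).2) ?_
    filter_upwards [f.2.eventually_analyticAt, g.2.eventually_analyticAt] with y h1 h2
    change fderiv ℂ (f.1 + g.1) y _ = fderiv ℂ f.1 y _ + fderiv ℂ g.1 y _
    rw [fderiv_add h1.differentiableAt h2.differentiableAt]
    rfl
  map_smul' c f := by
    rw [RingHom.id_apply, ← germ_smul c (analyticAt_pderivFun p f.2)]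
    refine germ_eq_of_eventuallyEq (analyticAt_pderivFun p (c • f).2) ?_
    filter_upwards [f.2.eventually_analyticAt] with y h1
    change fderiv ℂ (c • f.1) y _ = c • fderiv ℂ f.1 y _
    rw [fderiv_const_smul h1.differentiableAt]
    rfl

theorem pderivPre_mul {k : ℕ} (x : Fin k → ℂ) (p : Fin k) (f g : holAt x) :
    pderivPre x p (f * g) =
      toStalk x f * pderivPre x p g +
        toStalk x g * pderivPre x p f := by
  have hf := analyticAt_pderivFun p f.2
  have hg := analyticAt_pderivFun p g.2
  change germ x (pderivFun p (f.1 * g.1)) =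
    _ * germ x (pderivFun p g.1) + _ * germ x (pderivFun p f.1)
  rw [← germ_of_mem f, ← germ_of_mem g, ← germ_mul f.2 hg, ← germ_mul g.2 hf,
    ← germ_add (f.2.mul hg) (g.2.mul hf)]
  refine germ_eq_of_eventuallyEq (analyticAt_pderivFun p (f * g).2) ?_
  filter_upwards [f.2.eventually_analyticAt, g.2.eventually_analyticAt] with y h1 h2
  change fderiv ℂ (f.1 * g.1) y _ = f.1 y * fderiv ℂ g.1 y _ + g.1 y * fderiv ℂ f.1 y _
  rw [fderiv_mul h1.differentiableAt h2.differentiableAt]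
  rfl

/-- The derivation `∂_p` of `𝒪_{N,x}` (coordinates are numbered from `0`, so `p : Fin k` stands for
the coordinate `σ_{p+1}`). -/
def pderivStalk {k : ℕ} (x : Fin k → ℂ) (p : Fin k) : Derivation ℂ (Stalk x) (Stalk x) :=
  Derivation.mk'
    (Submodule.liftQ ((nullAt x).restrictScalars ℂ) (pderivPre x p) (by
      intro f hf
      have h0 : (f.1 : (Fin k → ℂ) → ℂ) =ᶠ[𝓝 x] fun _ => 0 := hf
      have h1 : pderivFun p f.1 =ᶠ[𝓝 x] fun _ => 0 := by
        filter_upwards [h0.fderiv (𝕜 := ℂ)] with y hy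
        simp [pderivFun, hy]
      change germ x (pderivFun p f.1) = 0
      rw [germ_eq_of_eventuallyEq (analyticAt_pderivFun p f.2) h1, germ,
        dif_pos analyticAt_const]
      rfl) : Stalk x →ₗ[ℂ] Stalk x)
    (by
      intro a b
      obtain ⟨f, rfl⟩ := toStalk_surjective x a
      obtain ⟨g, rfl⟩ := toStalk_surjective x b
      exact pderivPre_mul x p f g)

/-- The defining property of `∂_p` on germs. -/
theorem pderivStalk_germ {k : ℕ} (x : Fin k → ℂ) (p : Fin k) {f : (Fin k → ℂ) → ℂ}
    (hf : AnalyticAt ℂ f x) : pderivStalk x p (germ x f) = germ x (pderivFun p f) := by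
  rw [germ_of_mem (⟨f, hf⟩ : holAt x)]
  rfl

/-- The ring homomorphism `f ↦ f + d(f) ε` from `R` to the dual numbers over an `R`-algebra. -/
def dualHom {R S : Type} [CommRing R] [Algebra ℂ R] [CommRing S] [Algebra R S]
    (d : Derivation ℂ R R) : R →+* TrivSqZeroExt S S where
  toFun f := (algebraMap R S f, algebraMap R S (d f))
  map_one' := TrivSqZeroExt.ext (map_one _)
    (by change algebraMap R S (d 1) = 0; rw [d.map_one_eq_zero, map_zero])
  map_mul' a b := TrivSqZeroExt.ext (map_mul _ a b) (by
    change algebraMap R S (d (a * b)) =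
      algebraMap R S a * algebraMap R S (d b) + algebraMap R S (d a) * algebraMap R S b
    rw [d.leibniz, map_add, smul_eq_mul, smul_eq_mul, map_mul, map_mul,
      mul_comm (algebraMap R S b)])
  map_zero' := TrivSqZeroExt.ext (map_zero _)
    (by change algebraMap R S (d 0) = 0; rw [map_zero, map_zero])
  map_add' a b := TrivSqZeroExt.ext (map_add _ a b)
    (by change algebraMap R S (d (a + b)) = _ + _; rw [map_add, map_add])

theorem dualHom_fst {R S : Type} [CommRing R] [Algebra ℂ R] [CommRing S] [Algebra R S]
    (d : Derivation ℂ R R) (f : R) : (dualHom (S := S) d f).fst = algebraMap R S f := rfl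

theorem dualHom_snd {R S : Type} [CommRing R] [Algebra ℂ R] [CommRing S] [Algebra R S]
    (d : Derivation ℂ R R) (f : R) : (dualHom (S := S) d f).snd = algebraMap R S (d f) := rfl

theorem isUnit_dualHom {R : Type} [CommRing R] [Algebra ℂ R] (h : R) (d : Derivation ℂ R R) :
    IsUnit (dualHom (S := Localization.Away h) d h) := by
  rw [TrivSqZeroExt.isUnit_iff_isUnit_fst]
  simpa [dualHom_fst] using IsLocalization.Away.algebraMap_isUnit (S := Localization.Away h) h

/-- The extension of `dualHom` to `R[1/h]`. -/
def dualLift {R : Type} [CommRing R] [Algebra ℂ R] (h : R) (d : Derivation ℂ R R) :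
    Localization.Away h →+* TrivSqZeroExt (Localization.Away h) (Localization.Away h) :=
  IsLocalization.Away.lift h (isUnit_dualHom h d)

theorem dualLift_algebraMap {R : Type} [CommRing R] [Algebra ℂ R] (h : R) (d : Derivation ℂ R R)
    (f : R) : dualLift h d (algebraMap R _ f) = dualHom d f :=
  IsLocalization.Away.lift_eq h (isUnit_dualHom h d) f

theorem dualLift_fst {R : Type} [CommRing R] [Algebra ℂ R] (h : R) (d : Derivation ℂ R R)
    (s : Localization.Away h) : (dualLift h d s).fst = s := by
  have : (TrivSqZeroExt.fstHom (Localization.Away h) (Localization.Away h)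
      (Localization.Away h)).toRingHom.comp (dualLift h d) = RingHom.id _ := by
    refine IsLocalization.ringHom_ext (Submonoid.powers h) ?_
    ext r
    simp [dualLift_algebraMap, dualHom_fst]
  exact RingHom.congr_fun this s

/-- The extension of a derivation of `R` to the localization `R[1/h]`. -/
def awayDerivation {R : Type} [CommRing R] [Algebra ℂ R] (h : R) (d : Derivation ℂ R R) :
    Derivation ℂ (Localization.Away h) (Localization.Away h) :=
  Derivation.mk'
    { toFun := fun s => (dualLift h d s).snd
      map_add' := by intro a b; simp
      map_smul' := by
        intro c s
        have hc : dualLift h d (algebraMap ℂ _ c) = TrivSqZeroExt.inl (algebraMap ℂ _ c) := by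
          rw [IsScalarTower.algebraMap_apply ℂ R (Localization.Away h), dualLift_algebraMap]
          refine TrivSqZeroExt.ext ?_ ?_
          · rw [dualHom_fst, TrivSqZeroExt.fst_inl, ← IsScalarTower.algebraMap_apply]
          · rw [dualHom_snd, d.map_algebraMap, map_zero, TrivSqZeroExt.snd_inl]
        rw [Algebra.smul_def, map_mul, hc, RingHom.id_apply, Algebra.smul_def]
        simp }
    (by
      intro a b
      change (dualLift h d (a * b)).snd = a * (dualLift h d b).snd + b * (dualLift h d a).snd
      rw [map_mul, TrivSqZeroExt.snd_mul, dualLift_fst, dualLift_fst]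
      simp [mul_comm])

/-- The defining property of the extension of a derivation to `R[1/h]`. -/
theorem awayDerivation_algebraMap {R : Type} [CommRing R] [Algebra ℂ R] (h : R)
    (d : Derivation ℂ R R) (f : R) :
    awayDerivation h d (algebraMap R (Localization.Away h) f) = algebraMap R _ (d f) := by
  change (dualLift h d (algebraMap R _ f)).snd = _
  rw [dualLift_algebraMap, dualHom_snd]

/-! ### The ring of differential operators -/

/-- The stalk `𝒟_{N,x}`: the operators on `𝒪_{N,x}` generated by the multiplications by germs and
the `∂_p`. -/
def diffOps {k : ℕ} (x : Fin k → ℂ) : Subalgebra ℂ (Module.End ℂ (Stalk x)) :=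
  Algebra.adjoin ℂ
    (Set.range (fun f : Stalk x => LinearMap.mulLeft ℂ f) ∪
      Set.range (fun p : Fin k => (pderivStalk x p : Stalk x →ₗ[ℂ] Stalk x)))

/-- The stalk `𝒟_{N,x}` as a type. -/
def DiffOp {k : ℕ} (x : Fin k → ℂ) : Type := diffOps x

instance {k : ℕ} (x : Fin k → ℂ) : Ring (DiffOp x) := inferInstanceAs (Ring (diffOps x))

instance {k : ℕ} (x : Fin k → ℂ) : Algebra ℂ (DiffOp x) :=
  inferInstanceAs (Algebra ℂ (diffOps x))

/-- Multiplication by a germ, as a differential operator. -/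
def mulOp {k : ℕ} {x : Fin k → ℂ} (f : Stalk x) : DiffOp x :=
  (⟨LinearMap.mulLeft ℂ f, Algebra.subset_adjoin (Or.inl ⟨f, rfl⟩)⟩ : diffOps x)

/-- `∂_p` as a differential operator. -/
def dOp {k : ℕ} (x : Fin k → ℂ) (p : Fin k) : DiffOp x :=
  (⟨(pderivStalk x p : Stalk x →ₗ[ℂ] Stalk x), Algebra.subset_adjoin (Or.inr ⟨p, rfl⟩)⟩ :
    diffOps x)

/-- The monomial `∂^α`. -/
def dMonomial {k : ℕ} (x : Fin k → ℂ) (α : Fin k → ℕ) : DiffOp x :=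
  (List.ofFn fun p => dOp x p ^ α p).prod

/-- The germ at `x` of the coordinate function `σ_{p+1}`. -/
def coord {k : ℕ} (x : Fin k → ℂ) (p : Fin k) : Stalk x := germ x fun y => y p

/-- `E = ∑ σ_h ∂_h`. -/
def opE {k : ℕ} (x : Fin k → ℂ) : DiffOp x := ∑ h : Fin k, mulOp (coord x h) * dOp x h

/-- `U_0 = ∑ h σ_h ∂_h`. -/
def opU0 {k : ℕ} (x : Fin k → ℂ) : DiffOp x :=
  ∑ h : Fin k, (((h : ℕ) : ℂ) + 1) • (mulOp (coord x h) * dOp x h)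

/-- The left ideal `𝒜` generated by the `∂_i ∂_j - ∂_{i+1} ∂_{j-1}`. -/
def idealA {k : ℕ} (x : Fin k → ℂ) : Submodule (DiffOp x) (DiffOp x) :=
  Submodule.span (DiffOp x)
    {P | ∃ i j i' j' : Fin k, (i' : ℕ) = i + 1 ∧ (j : ℕ) = j' + 1 ∧
      P = dOp x i * dOp x j - dOp x i' * dOp x j'}

/-- The left ideal `ℐ_μ`, generated by `𝒜` and the `∂_1 ∂_{m-1} + ∂_m (E + μ)`. -/
def idealI {k : ℕ} [NeZero k] (μ : ℂ) (x : Fin k → ℂ) : Submodule (DiffOp x) (DiffOp x) :=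
  idealA x ⊔ Submodule.span (DiffOp x)
    {P | ∃ m' m : Fin k, (m : ℕ) = m' + 1 ∧
      P = dOp x 0 * dOp x m' + dOp x m * (opE x + algebraMap ℂ (DiffOp x) μ)}

/-- The left ideal `𝒥_{μ,lam} = ℐ_μ + 𝒟_N (U_0 - lam)`. -/
def idealJ {k : ℕ} [NeZero k] (μ lam : ℂ) (x : Fin k → ℂ) : Submodule (DiffOp x) (DiffOp x) :=
  idealI μ x ⊔ Submodule.span (DiffOp x) {opU0 x - algebraMap ℂ (DiffOp x) lam}

/-- The stalk at `x` of `𝒩_{μ,lam} = 𝒟_N / 𝒥_{μ,lam}`. -/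
def ModN {k : ℕ} [NeZero k] (μ lam : ℂ) (x : Fin k → ℂ) : Type := DiffOp x ⧸ idealJ μ lam x

instance {k : ℕ} [NeZero k] (μ lam : ℂ) (x : Fin k → ℂ) : AddCommGroup (ModN μ lam x) :=
  inferInstanceAs (AddCommGroup (DiffOp x ⧸ idealJ μ lam x))

instance {k : ℕ} [NeZero k] (μ lam : ℂ) (x : Fin k → ℂ) : Module (DiffOp x) (ModN μ lam x) :=
  inferInstanceAs (Module (DiffOp x) (DiffOp x ⧸ idealJ μ lam x))

/-- The class in `𝒩_{μ,lam}` of a differential operator. -/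
def ModN.mk {k : ℕ} [NeZero k] (μ lam : ℂ) (x : Fin k → ℂ) : DiffOp x →ₗ[DiffOp x] ModN μ lam x :=
  (idealJ μ lam x).mkQ

/-! ### The hypersurface -/

/-- The universal polynomial `P_σ(z) = z^k + ∑_{h=1}^k (-1)^h σ_h z^{k-h}`. -/
def univPoly (k : ℕ) : Polynomial (MvPolynomial (Fin k) ℂ) :=
  Polynomial.X ^ k + ∑ h : Fin k,
    Polynomial.C ((-1) ^ ((h : ℕ) + 1) * MvPolynomial.X h) * Polynomial.X ^ (k - ((h : ℕ) + 1))

/-- The polynomial `σ_k Δ(σ)`, where `Δ` is the discriminant of the universal polynomial. -/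
def hypPoly (k : ℕ) [NeZero k] : MvPolynomial (Fin k) ℂ :=
  MvPolynomial.X ⟨k - 1, Nat.sub_one_lt (NeZero.ne k)⟩ * (univPoly k).discr

/-- The function `σ_k Δ(σ)` on `N`. -/
def hyp {k : ℕ} [NeZero k] (y : Fin k → ℂ) : ℂ := MvPolynomial.eval y (hypPoly k)

/-- The stalk at `x` of `𝒪_N(*σ_kΔ)`. -/
def Mero {k : ℕ} [NeZero k] (x : Fin k → ℂ) : Type := Localization.Away (germ x (hyp (k := k)))

instance {k : ℕ} [NeZero k] (x : Fin k → ℂ) : CommRing (Mero x) :=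
  inferInstanceAs (CommRing (Localization.Away (germ x (hyp (k := k)))))

instance {k : ℕ} [NeZero k] (x : Fin k → ℂ) : Algebra ℂ (Mero x) :=
  inferInstanceAs (Algebra ℂ (Localization.Away (germ x (hyp (k := k)))))

instance {k : ℕ} [NeZero k] (x : Fin k → ℂ) : Algebra (Stalk x) (Mero x) :=
  inferInstanceAs (Algebra (Stalk x) (Localization.Away (germ x (hyp (k := k)))))

/-- The derivation `∂_p` of `𝒪_N(*σ_kΔ)_x`. -/
def pderivMero {k : ℕ} [NeZero k] (x : Fin k → ℂ) (p : Fin k) :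
    Derivation ℂ (Mero x) (Mero x) :=
  awayDerivation (germ x (hyp (k := k))) (pderivStalk x p)

/-! ### Connections -/

/-- The covariant derivative `∇_p = ∂_p + C_p` on `S^k`, where `S` carries derivations `∂_p`. -/
def covDer {k : ℕ} {S : Type} [CommRing S] [Algebra ℂ S] (d : Fin k → Derivation ℂ S S)
    (C : Fin k → Matrix (Fin k) (Fin k) S) (p : Fin k) : Module.End ℂ (Fin k → S) where
  toFun v i := d p (v i) + ∑ j, C p i j * v j
  map_add' v w := by
    ext i
    simp only [Pi.add_apply, map_add, mul_add, Finset.sum_add_distrib]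
    ring
  map_smul' c v := by
    ext i
    simp [Finset.smul_sum]

/-- The matrices `B_p / (σ_kΔ)` in an `𝒪_{N,x}`-algebra `S` in which `σ_kΔ` is invertible. -/
def connMatrix {k : ℕ} [NeZero k] (B : Fin k → Matrix (Fin k) (Fin k) ((Fin k → ℂ) → ℂ))
    (x : Fin k → ℂ) (S : Type) [CommRing S] [Algebra (Stalk x) S] (p : Fin k) :
    Matrix (Fin k) (Fin k) S :=
  fun i j => Ring.inverse (algebraMap (Stalk x) S (germ x hyp)) *
    algebraMap (Stalk x) S (germ x (B p i j))

/-- An integrable meromorphic connection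
`∇ = d + (1/(σ_kΔ)) ∑_p B_p dσ_p : 𝒪_N^k → (1/(σ_kΔ)) 𝒪_N^k ⊗ Ω^1_N` on the trivial bundle of rank
`k`, the `B_p` being matrices of holomorphic functions on `N`. -/
structure SimplePoleConnection (k : ℕ) [NeZero k] where
  /-- The numerators of the connection matrices. -/
  B : Fin k → Matrix (Fin k) (Fin k) ((Fin k → ℂ) → ℂ)
  holomorphic : ∀ p i j, AnalyticOnNhd ℂ (B p i j) Set.univ
  integrable : ∀ (x : Fin k → ℂ) (p q : Fin k),
    covDer (pderivMero x) (connMatrix B x (Mero x)) p *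
        covDer (pderivMero x) (connMatrix B x (Mero x)) q =
      covDer (pderivMero x) (connMatrix B x (Mero x)) q *
        covDer (pderivMero x) (connMatrix B x (Mero x)) p

/-- `ρ` is the `𝒟_{N,x}`-module structure of `(𝒪_N^k(*σ_kΔ), ∇)` at `x`: germs of functions act by
multiplication and `∂_p` acts by `∇_p`. -/
def SimplePoleConnection.IsActionMero {k : ℕ} [NeZero k] (conn : SimplePoleConnection k)
    (x : Fin k → ℂ) (ρ : DiffOp x →ₐ[ℂ] Module.End ℂ (Fin k → Mero x)) : Prop :=
  (∀ (f : Stalk x) (v : Fin k → Mero x), ρ (mulOp f) v = f • v) ∧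
    ∀ p, ρ (dOp x p) = covDer (pderivMero x) (connMatrix conn.B x (Mero x)) p

/-- `ρ` is the `𝒟_{N,x}`-module structure of `(𝒪_N^k, ∇)` at a point `x` where `σ_kΔ ≠ 0`. -/
def SimplePoleConnection.IsActionHol {k : ℕ} [NeZero k] (conn : SimplePoleConnection k)
    (x : Fin k → ℂ) (ρ : DiffOp x →ₐ[ℂ] Module.End ℂ (Fin k → Stalk x)) : Prop :=
  (∀ (f : Stalk x) (v : Fin k → Stalk x), ρ (mulOp f) v = f • v) ∧
    ∀ p, ρ (dOp x p) = covDer (pderivStalk x) (connMatrix conn.B x (Stalk x)) p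

/-! ### Sections over open sets, as families of germs -/

/-- `P` is a section of `𝒟_N` over `V`: near each point it is given by one finite expression
`∑ a_α ∂^α` with holomorphic coefficients. -/
def IsSectionD {k : ℕ} (V : Set (Fin k → ℂ)) (P : ∀ y : Fin k → ℂ, DiffOp y) : Prop :=
  ∀ x ∈ V, ∃ (s : Finset (Fin k → ℕ)) (a : (Fin k → ℕ) → (Fin k → ℂ) → ℂ),
    (∀ α ∈ s, AnalyticAt ℂ (a α) x) ∧
      ∀ᶠ y in 𝓝 x, P y = ∑ α ∈ s, mulOp (germ y (a α)) * dMonomial y α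

/-- `n` is a section of the quotient sheaf `𝒩_{μ,lam}` over `V`: locally the class of a section
of `𝒟_N`. -/
def IsSectionN {k : ℕ} [NeZero k] (μ lam : ℂ) (V : Set (Fin k → ℂ))
    (n : ∀ y : Fin k → ℂ, ModN μ lam y) : Prop :=
  ∀ x ∈ V, ∃ (W : Set (Fin k → ℂ)) (P : ∀ y : Fin k → ℂ, DiffOp y),
    IsOpen W ∧ x ∈ W ∧ IsSectionD W P ∧ ∀ y ∈ W, n y = ModN.mk μ lam y (P y)

/-- `v` is a section of `𝒪_N^k(*σ_kΔ)` over `V`: locally `v = (f_1, …, f_k) / (σ_kΔ)^n` with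
holomorphic `f_i`. -/
def IsSectionMero {k : ℕ} [NeZero k] (V : Set (Fin k → ℂ))
    (v : ∀ y : Fin k → ℂ, Fin k → Mero y) : Prop :=
  ∀ x ∈ V, ∃ (n : ℕ) (f : Fin k → (Fin k → ℂ) → ℂ), (∀ i, AnalyticAt ℂ (f i) x) ∧
    ∀ᶠ y in 𝓝 x, ∀ i, germ y hyp ^ n • v y i = algebraMap (Stalk y) (Mero y) (germ y (f i))

/-- A `𝒟_N`-linear morphism of sheaves `𝒩_{μ,lam} → 𝒪_N^k(*σ_kΔ)`, the target having the
`𝒟_N`-module structure `ρ`: a family of `𝒟_{N,x}`-linear maps of stalks which maps sections to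
sections. -/
structure IsSheafMorphism {k : ℕ} [NeZero k] (μ lam : ℂ)
    (ρ : ∀ x : Fin k → ℂ, DiffOp x →ₐ[ℂ] Module.End ℂ (Fin k → Mero x))
    (φ : ∀ x : Fin k → ℂ, ModN μ lam x →+ (Fin k → Mero x)) : Prop where
  linear : ∀ x (P : DiffOp x) (n : ModN μ lam x), φ x (P • n) = ρ x P (φ x n)
  sections : ∀ (V : Set (Fin k → ℂ)) (n : ∀ y : Fin k → ℂ, ModN μ lam y), IsOpen V →
    IsSectionN μ lam V n → IsSectionMero V fun y => φ y (n y)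

end TraceSystem

end

/-! Modulo `idealA` a monomial `∂^α` depends only on its order `q = |α|` and its weight `n = ∑ h
α_h`; write `y(q, n)` for its class. Multiplying the remaining generators of `idealI` by monomials
gives `y(q+1, n) = -∑ σ_h y(q+1, n+h) - (μ+q) y(q, n)` for `n ≤ kq`. Every class is thus a
combination of the `b_n = y(q, n)` with `q` least such that `n ≤ kq`. `modelY` solves this recursion
in the free module on `(b_n)`, `n ≥ 0`. The `∂_p` act there by raising `(q, n)` to `(q+1, n+p)`;
they commute and satisfy the Leibniz rule, so by the universal property of the ring of operators
(`DiffOp.exists_lift`) the free module is a `𝒟`-module, and it is exactly `𝒟 / ℐ_μ`.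

Right multiplication by `U_0 - λ` becomes an `𝒪`-linear endomorphism `modelU` commuting with the
`𝒟`-action, and `𝒩_{μ,λ}` is its cokernel (`mem_idealJ_iff`). Two views of this endomorphism carry
the theorem.

Triangularity: the image of `b_n` is `(n - λ) b_n` plus terms in `b_i` with `i > n`. As `λ ∉ ℕ`, the
diagonal consists of units, so divisibility by a non-zero-divisor descends from the image to the
preimage, and the cokernel has no torsion (`modelU_torsionFree`).

Symbols: filter by order. Each quotient of consecutive steps above order `0` is `S[z]/(Q)` with `Q =
z^k + ∑ σ_h z^{k-h}`, and `U_0` acts on it by `∑ h σ_h z^{k-h}`, that is `-zQ'(z)`. Bézout relations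
show that this divides `σ_kΔ`. Hence each factor `σ_kΔ` lowers the order by one modulo the image
(`exists_smul_sub_modelU_mem`). In order one, `b_0` is eliminated because `λ ≠ 0`. Once `σ_kΔ` is
inverted, the cokernel is free on `b_1, …, b_k` (`exists_isModelProj`), and `∂_p` descends to a
connection. Since `∂_p b_j = y(2, j+p)` has order two, one factor `σ_kΔ` suffices: the pole is
simple. The numerators come from a computation over the polynomial ring, hence are global.
Integrability is inherited from the model.

Finally, `𝒩 → 𝒪^k(*σ_kΔ)` is injective because an element of its kernel is killed by a power of
`σ_kΔ`, hence vanishes by torsion-freeness. -/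

noncomputable section

open scoped Topology

namespace TraceSystem

/-! ### A free model of `𝒟_N / ℐ_μ` -/

section Model

variable {k : ℕ} {S : Type} [CommRing S]

/-- The class of `∂^α`, `|α| = q`, `∑ p α_p = n`, in terms of the basis `(b_n)` of the model. -/
def modelY (s : Fin k → S) (mu : S) : ℕ → ℕ → (ℕ →₀ S)
  | 0, n => Finsupp.single n 1
  | q + 1, n =>
    -- A word of length `q` has weight at most `k q`, so beyond that bound no relation is available
    -- and a new basis vector starts. For `n < q` no monomial has order `q` and weight `n`; those
    -- values only extend the recursion formally.
    if _h : k * q < n then Finsupp.single n 1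
    else -(∑ p : Fin k, s p • modelY s mu (q + 1) (n + p + 1)) - (mu + q) • modelY s mu q n
termination_by q n => (q, k * q - n)
decreasing_by
  · have := p.2
    refine Prod.Lex.right _ ?_
    rw [mul_add]
    omega
  · exact Prod.Lex.left _ _ (Nat.lt_succ_self q)

theorem modelY_zero (s : Fin k → S) (mu : S) (n : ℕ) :
    modelY s mu 0 n = Finsupp.single n 1 := by rw [modelY]

theorem modelY_of_lt (s : Fin k → S) (mu : S) {q n : ℕ} (h : k * q < n) :
    modelY s mu (q + 1) n = Finsupp.single n 1 := by rw [modelY, dif_pos h]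

theorem modelY_of_le (s : Fin k → S) (mu : S) {q n : ℕ} (h : n ≤ k * q) :
    modelY s mu (q + 1) n =
      -(∑ p : Fin k, s p • modelY s mu (q + 1) (n + p + 1)) - (mu + q) • modelY s mu q n := by
  rw [modelY, dif_neg h.not_gt]

/-- Induction along the recursive definition of `modelY`. -/
theorem model_induction {P : ∀ q n : ℕ, n ≤ k * q → Prop} (zero : P 0 0 (Nat.zero_le _))
    (top : ∀ q n, k * q < n → ∀ h : n ≤ k * (q + 1), P (q + 1) n h)
    (step : ∀ q n (h : n ≤ k * q) (h' : n ≤ k * (q + 1))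
      (hp : ∀ p : Fin k, n + p + 1 ≤ k * (q + 1)), (∀ p : Fin k, P (q + 1) (n + p + 1) (hp p)) →
      P q n h → P (q + 1) n h') (q n : ℕ) (h : n ≤ k * q) : P q n h := by
  induction q generalizing n with
  | zero => obtain rfl : n = 0 := by simpa using h
            exact zero
  | succ q ih =>
    induction hd : k * (q + 1) - n using Nat.strong_induction_on generalizing n with
    | _ d ihd =>
      by_cases hn : k * q < n
      · exact top q n hn h
      · have h1 : ∀ p : Fin k, n + p + 1 ≤ k * (q + 1) := by
          intro p
          have := p.2
          rw [mul_add]; omega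
        exact step q n (not_lt.mp hn) h h1 (fun p => ihd _ (by have := h1 p; omega) _ (h1 p) rfl)
          (ih n (not_lt.mp hn))

/-- The least `q` with `n ≤ k q`. -/
def level (k n : ℕ) : ℕ := (n + k - 1) / k

/-! ### Levels of basis vectors and the endomorphism given by `U_0 - lam` -/

variable [NeZero k]

theorem level_eq {q n : ℕ} (h : k * q < n) (h' : n ≤ k * (q + 1)) : level k n = q + 1 := by
  have hk : 0 < k := Nat.pos_of_neZero k
  rw [level]
  rw [mul_add] at h'
  refine Nat.div_eq_of_lt_le ?_ ?_ <;> rw [mul_comm _ k] <;> simp only [mul_add] <;> omega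

theorem level_zero : level k 0 = 0 := by
  have hk : 0 < k := Nat.pos_of_neZero k
  rw [level]
  exact Nat.div_eq_of_lt (by omega)

theorem level_cases (k n : ℕ) [NeZero k] :
    (n = 0 ∧ level k n = 0) ∨ ∃ q, level k n = q + 1 ∧ k * q < n ∧ n ≤ k * (q + 1) := by
  have hk : 0 < k := Nat.pos_of_neZero k
  rcases Nat.eq_zero_or_pos n with rfl | hn
  · exact Or.inl ⟨rfl, level_zero⟩
  · have h := Nat.div_add_mod (n - 1) k
    have h2 := Nat.mod_lt (n - 1) hk
    have h3 : k * ((n - 1) / k) < n := by omega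
    have h4 : n ≤ k * ((n - 1) / k + 1) := by rw [mul_add]; omega
    exact Or.inr ⟨(n - 1) / k, level_eq h3 h4, h3, h4⟩

theorem le_mul_level (n : ℕ) : n ≤ k * level k n := by
  rcases level_cases k n with ⟨rfl, _⟩ | ⟨q, h, _, h'⟩
  · exact Nat.zero_le _
  · rwa [h]

theorem level_le {q n : ℕ} (h : n ≤ k * q) : level k n ≤ q := by
  rcases level_cases k n with ⟨_, h0⟩ | ⟨q', h', h1, _⟩
  · omega
  · have := lt_of_mul_lt_mul_left (h1.trans_le h) (Nat.zero_le k)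
    omega

theorem modelY_level (s : Fin k → S) (mu : S) (n : ℕ) :
    modelY s mu (level k n) n = Finsupp.single n 1 := by
  rcases level_cases k n with ⟨_, h⟩ | ⟨q, h, h', _⟩
  · rw [h, modelY_zero]
  · rw [h, modelY_of_lt s mu h']

-- The recursion never lowers the weight. This is the source of the triangularity of `modelU`.
omit [NeZero k] in
theorem modelY_apply_of_lt (s : Fin k → S) (mu : S) (q n : ℕ) (h : n ≤ k * q) :
    ∀ i < n, modelY s mu q n i = 0 := by
  induction q, n, h using model_induction with
  | zero => intro i hi; exact absurd hi (Nat.not_lt_zero i)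
  | top q n h1 h2 =>
    intro i hi
    rw [modelY_of_lt s mu h1, Finsupp.single_eq_of_ne (by omega)]
  | step q n h1 h1' h2 h2' h3 =>
    intro i hi
    rw [modelY_of_le s mu h1]
    simp only [Finsupp.sub_apply, Finsupp.neg_apply, Finsupp.finsetSum_apply,
      Finsupp.smul_apply, h3 i hi, smul_zero, sub_zero, neg_eq_zero]
    refine Finset.sum_eq_zero fun p _ => ?_
    rw [h2' p i (by omega), smul_zero]

-- The recursion never raises the order; this gives the order filtration `modelF`.
omit [NeZero k] in
theorem modelY_apply_of_gt (s : Fin k → S) (mu : S) (q n : ℕ) (h : n ≤ k * q) :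
    ∀ i, k * q < i → modelY s mu q n i = 0 := by
  induction q, n, h using model_induction with
  | zero => intro i hi; rw [modelY_zero, Finsupp.single_eq_of_ne (by omega)]
  | top q n h1 h2 =>
    intro i hi
    rw [modelY_of_lt s mu h1, Finsupp.single_eq_of_ne (by omega)]
  | step q n h1 h1' h2 h2' h3 =>
    intro i hi
    have hi' : k * q < i := by rw [mul_add] at hi; omega
    rw [modelY_of_le s mu h1]
    simp only [Finsupp.sub_apply, Finsupp.neg_apply, Finsupp.finsetSum_apply,
      Finsupp.smul_apply, h3 i hi', smul_zero, sub_zero, neg_eq_zero]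
    refine Finset.sum_eq_zero fun p _ => ?_
    rw [h2' p i hi, smul_zero]

/-- The action of `U_0 - lam` from the right on the model of `𝒟_N / ℐ_μ`. -/
def modelU (s : Fin k → S) (mu lam : S) : (ℕ →₀ S) →ₗ[S] (ℕ →₀ S) :=
  Finsupp.linearCombination S fun n =>
    ∑ p : Fin k, ((p : ℕ) + 1 : S) • s p • modelY s mu (level k n + 1) (n + p + 1) +
      ((n : S) - lam) • Finsupp.single n 1

omit [NeZero k] in
theorem modelU_single (s : Fin k → S) (mu lam : S) (n : ℕ) :
    modelU s mu lam (Finsupp.single n 1) =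
      ∑ p : Fin k, ((p : ℕ) + 1 : S) • s p • modelY s mu (level k n + 1) (n + p + 1) +
      ((n : S) - lam) • Finsupp.single n 1 := by
  rw [modelU, Finsupp.linearCombination_single, one_smul]

/-- The commutation rule for `∂^α (U_0 - lam)`. `modelU` is prescribed only on the basis; the
content is that the rule is compatible with the recursion, so that it holds for all classes. -/
theorem modelU_modelY (s : Fin k → S) (mu lam : S) (q n : ℕ) (h : n ≤ k * q) :
    modelU s mu lam (modelY s mu q n) =
      ∑ p : Fin k, ((p : ℕ) + 1 : S) • s p • modelY s mu (q + 1) (n + p + 1) +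
      ((n : S) - lam) • modelY s mu q n := by
  induction q, n, h using model_induction with
  | zero => rw [modelY_zero, modelU_single, level_zero]
  | top q n h1 h2 => rw [modelY_of_lt s mu h1, modelU_single, level_eq h1 h2]
  | step q n h1 h1' h2 h2' h3 =>
    have e : ∀ p : Fin k, modelY s mu (q + 1 + 1) (n + p + 1) =
        -(∑ l : Fin k, s l • modelY s mu (q + 1 + 1) (n + l + 1 + p + 1)) -
          (mu + q + 1) • modelY s mu (q + 1) (n + p + 1) := by
      intro p
      rw [modelY_of_le s mu (h2 p)]
      push_cast
      congr 2
      · refine Finset.sum_congr rfl fun l _ => ?_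
        rw [show n + l + 1 + p + 1 = n + p + 1 + l + 1 by omega]
      · ring
    rw [modelY_of_le s mu h1]
    simp only [map_sub, map_neg, map_sum, map_smul, h3]
    simp only [h2' _, e]
    simp only [smul_sub, smul_neg, Finset.smul_sum, smul_add, Finset.sum_add_distrib,
      Finset.sum_sub_distrib, Finset.sum_neg_distrib, neg_add]
    -- The shift from the recursion and the shift from `U_0` commute, so the double sums on the two
    -- sides agree.
    have c : ∑ x : Fin k, ∑ l : Fin k, s x • ((l : ℕ) + 1 : S) • s l •
        modelY s mu (q + 1 + 1) (n + x + 1 + l + 1) =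
        ∑ l : Fin k, ∑ x : Fin k, ((l : ℕ) + 1 : S) • s l • s x •
        modelY s mu (q + 1 + 1) (n + x + 1 + l + 1) := by
      rw [Finset.sum_comm]
      refine Finset.sum_congr rfl fun l _ => Finset.sum_congr rfl fun x _ => ?_
      module
    rw [c]
    -- The shift raises the weight by `x + 1`. The extra sum split off here matches the one that
    -- `c3` splits off on the other side, where the order, and with it `mu + q`, has gone up by one.
    have c2 : ∑ x : Fin k, s x • (((n + x + 1 : ℕ) : S) - lam) •
        modelY s mu (q + 1) (n + x + 1) = 
        ∑ x : Fin k, ((n : S) - lam) • s x • modelY s mu (q + 1) (n + x + 1) +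
        ∑ x : Fin k, ((x : ℕ) + 1 : S) • s x • modelY s mu (q + 1) (n + x + 1) := by
      rw [← Finset.sum_add_distrib]
      refine Finset.sum_congr rfl fun x _ => ?_
      push_cast
      module
    rw [c2]
    have c3 : ∑ x : Fin k, ((x : ℕ) + 1 : S) • s x • (mu + q + 1) •
        modelY s mu (q + 1) (n + x + 1) = 
        ∑ x : Fin k, ((x : ℕ) + 1 : S) • s x • modelY s mu (q + 1) (n + x + 1) +
        ∑ x : Fin k, (mu + q) • ((x : ℕ) + 1 : S) • s x • modelY s mu (q + 1) (n + x + 1) := by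
      rw [← Finset.sum_add_distrib]
      refine Finset.sum_congr rfl fun x _ => ?_
      module
    rw [c3]
    module

/-- The `n`-th coordinate of the image involves only the `w i` with `i ≤ n`: the diagonal
contributes `(n - lam) w n`, and the terms with `i < n` are multiples of `f` by assumption. -/
theorem modelU_apply (s : Fin k → S) (mu lam : S) (w : ℕ →₀ S) (n : ℕ)
    (f : S) (hw : ∀ i < n, f ∣ w i) :
    f ∣ modelU s mu lam w n - ((n : S) - lam) * w n := by
  have h : ∀ i, f ∣ w i * modelU s mu lam (Finsupp.single i 1) n -
      if i = n then ((n : S) - lam) * w i else 0 := by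
    intro i
    have hz : n ≤ i → (∑ p : Fin k, ((p : ℕ) + 1 : S) • s p •
        modelY s mu (level k i + 1) (i + p + 1)) n = 0 := by
      intro hi
      rw [Finsupp.finsetSum_apply]
      refine Finset.sum_eq_zero fun p _ => ?_
      have h1 := le_mul_level (k := k) i
      have h2 := p.2
      rw [Finsupp.smul_apply, Finsupp.smul_apply, modelY_apply_of_lt s mu _ _
        (by rw [mul_add]; omega) n (by omega), smul_zero, smul_zero]
    rcases lt_trichotomy i n with hi | rfl | hi
    · rw [if_neg hi.ne, sub_zero]
      exact (hw i hi).mul_right _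
    · rw [modelU_single, Finsupp.add_apply, hz le_rfl, if_pos rfl]
      simp [mul_comm]
    · rw [modelU_single, Finsupp.add_apply, hz hi.le, if_neg hi.ne']
      simp [hi.ne']
  have e : modelU s mu lam w n - ((n : S) - lam) * w n = 
      ∑ i ∈ insert n w.support, (w i * modelU s mu lam (Finsupp.single i 1) n -
      if i = n then ((n : S) - lam) * w i else 0) := by
    rw [Finset.sum_sub_distrib, Finset.sum_ite_eq' _ n, if_pos (Finset.mem_insert_self _ _)]
    congr 1
    have : w = ∑ i ∈ insert n w.support, w i • Finsupp.single i (1 : S) := by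
      conv_lhs => rw [← Finsupp.sum_single w]
      rw [Finsupp.sum_of_support_subset w (Finset.subset_insert n _) _ (by simp)]
      simp
    conv_lhs => rw [this]
    rw [map_sum, Finsupp.finsetSum_apply]
    refine Finset.sum_congr rfl fun i _ => ?_
    rw [map_smul, Finsupp.smul_apply, smul_eq_mul]
  rw [e]
  exact Finset.dvd_sum fun i _ => h i

/-- The cokernel of `modelU` has no torsion: in the basis `(b_n)` the map is triangular with the
units `n - lam` on the diagonal. -/
theorem modelU_torsionFree (s : Fin k → S) (mu lam : S) (hl : ∀ n : ℕ, IsUnit ((n : S) - lam))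
    {f : S} (hf : f ∈ nonZeroDivisors S) {v w : ℕ →₀ S} (h : f • v = modelU s mu lam w) :
    ∃ w', v = modelU s mu lam w' := by
  -- If `f` divides all earlier coordinates of `w`, then it divides `(n - lam) w n`, and `n - lam`
  -- is a unit.
  have hw : ∀ n, f ∣ w n := by
    intro n
    induction n using Nat.strong_induction_on with
    | _ n ih =>
      have h1 := modelU_apply s mu lam w n f ih
      rw [← h, Finsupp.smul_apply, smul_eq_mul] at h1
      have h2 := (dvd_sub_right (dvd_mul_right f (v n))).mp h1
      exact ((hl n).dvd_mul_left).mp h2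
  choose c hc using hw
  classical
  -- The quotients are forced to be zero off the support of `w`, so that `w'` is finitely supported.
  let w' : ℕ →₀ S := Finsupp.onFinset w.support (fun n => if w n = 0 then 0 else c n) (by
    intro n hn
    rw [Finsupp.mem_support_iff]
    intro h0
    exact hn (if_pos h0))
  have e : w = f • w' := by
    ext n
    simp only [w', Finsupp.smul_apply, Finsupp.onFinset_apply, smul_eq_mul]
    split_ifs with h0
    · rw [h0, mul_zero]
    · exact hc n
  refine ⟨w', ?_⟩
  rw [e, map_smul] at h
  ext n
  have h2 := congrArg (fun m : ℕ →₀ S => m n) h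
  simp only [Finsupp.smul_apply, smul_eq_mul] at h2
  exact (mul_cancel_left_mem_nonZeroDivisors hf).mp h2

/-! #### The connection on the model -/

/-- The action of `∂_p` on the model of `𝒟_N / ℐ_μ`. -/
def modelD [Algebra ℂ S] (d : Fin k → Derivation ℂ S S) (s : Fin k → S) (mu : S) (p : Fin k) :
    Module.End ℂ (ℕ →₀ S) :=
  Finsupp.mapRange.linearMap (d p : S →ₗ[ℂ] S) +
    (Finsupp.linearCombination S fun n =>
      modelY s mu (level k n + 1) (n + p + 1)).restrictScalars ℂ

variable [Algebra ℂ S] (d : Fin k → Derivation ℂ S S) (s : Fin k → S) (mu lam : S)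

omit [NeZero k] in
theorem modelD_smul (p : Fin k) (a : S) (m : ℕ →₀ S) :
    modelD d s mu p (a • m) = d p a • m + a • modelD d s mu p m := by
  have : Finsupp.mapRange.linearMap (d p : S →ₗ[ℂ] S) (a • m) =
      d p a • m + a • Finsupp.mapRange.linearMap (d p : S →ₗ[ℂ] S) m := by
    ext n
    simp [mul_comm, add_comm]
  simp only [modelD, LinearMap.add_apply, LinearMap.coe_restrictScalars, map_smul, this, smul_add]
  abel

omit [NeZero k] in
theorem modelD_single (p : Fin k) (n : ℕ) :
    modelD d s mu p (Finsupp.single n 1) = modelY s mu (level k n + 1) (n + p + 1) := by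
  simp [modelD]

/-- Differentiating the recursion, the derivative of the coefficient `s p` yields one more `y(q+1,
n+p+1)`; this is exactly what turns `mu + q` into the `mu + q + 1` of the next order. -/
theorem modelD_modelY (hd : ∀ p q, d p (s q) = if p = q then 1 else 0) (hmu : ∀ p, d p mu = 0)
    (p : Fin k) (q n : ℕ) (h : n ≤ k * q) :
    modelD d s mu p (modelY s mu q n) = modelY s mu (q + 1) (n + p + 1) := by
  induction q, n, h using model_induction with
  | zero => rw [modelY_zero, modelD_single, level_zero]
  | top q n h1 h2 => rw [modelY_of_lt s mu h1, modelD_single, level_eq h1 h2]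
  | step q n h1 h1' h2 h2' h3 =>
    rw [modelY_of_le s mu h1, modelY_of_le s mu (h2 p)]
    simp only [map_sub, map_neg, map_sum, modelD_smul, h3, h2' _, map_add, hd, hmu,
      Derivation.map_natCast, add_zero, zero_smul, zero_add, Finset.sum_add_distrib, ite_smul,
      one_smul, Finset.sum_ite_eq, Finset.mem_univ, if_true]
    have e : ∀ l : Fin k, n + l + 1 + p + 1 = n + p + 1 + l + 1 := fun l => by omega
    simp only [e]
    push_cast
    module

omit [NeZero k] [Algebra ℂ S] in
theorem model_ext {F G : (ℕ →₀ S) →+ (ℕ →₀ S)}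
    (h : ∀ (a : S) (n : ℕ), F (a • Finsupp.single n 1) = G (a • Finsupp.single n 1)) : F = G := by
  refine Finsupp.addHom_ext fun n a => ?_
  simpa using h a n

theorem modelD_comm (hd : ∀ p q, d p (s q) = if p = q then 1 else 0) (hmu : ∀ p, d p mu = 0)
    (hdd : ∀ p q a, d p (d q a) = d q (d p a)) (p q : Fin k) :
    modelD d s mu p * modelD d s mu q = modelD d s mu q * modelD d s mu p := by
  have : (modelD d s mu p * modelD d s mu q).toAddMonoidHom =
      (modelD d s mu q * modelD d s mu p).toAddMonoidHom := by
    refine model_ext fun a n => ?_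
    change modelD d s mu p (modelD d s mu q _) = modelD d s mu q (modelD d s mu p _)
    have h (p : Fin k) : n + p + 1 ≤ k * (level k n + 1) := by
      have := le_mul_level (k := k) n
      have := p.2
      rw [mul_add]; omega
    simp only [modelD_smul, map_add, modelD_single, modelD_modelY d s mu hd hmu _ _ _ (h _),
      hdd p q]
    rw [show n + q + 1 + p + 1 = n + p + 1 + q + 1 by omega]
    abel
  exact LinearMap.ext fun m => DFunLike.congr_fun this m

/-- Left and right multiplications commute. In coordinates, the derivative of `s p` accounts for the
change from weight `n` to weight `n + p + 1` in the diagonal coefficient. -/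
theorem modelD_modelU (hd : ∀ p q, d p (s q) = if p = q then 1 else 0) (hmu : ∀ p, d p mu = 0)
    (hlam : ∀ p, d p lam = 0) (p : Fin k) (m : ℕ →₀ S) :
    modelD d s mu p (modelU s mu lam m) = modelU s mu lam (modelD d s mu p m) := by
  have : (modelD d s mu p).toAddMonoidHom.comp (modelU s mu lam).toAddMonoidHom =
      (modelU s mu lam).toAddMonoidHom.comp (modelD d s mu p).toAddMonoidHom := by
    refine model_ext fun a n => ?_
    change modelD d s mu p (modelU s mu lam _) = modelU s mu lam (modelD d s mu p _)
    have h0 := le_mul_level (k := k) n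
    have h (p : Fin k) : n + p + 1 ≤ k * (level k n + 1) := by
      have := p.2
      rw [mul_add]; omega
    rw [map_smul, modelD_smul, modelD_smul, map_add, map_smul, map_smul, modelD_single,
      ← modelY_level s mu n, modelU_modelY s mu lam _ _ h0, modelU_modelY s mu lam _ _ (h p)]
    congr 2
    have hp : ∀ (x : Fin k), d p ((x : ℕ) + 1 : S) = 0 := fun x => by
      rw [map_add, Derivation.map_natCast, Derivation.map_one_eq_zero, add_zero]
    simp only [map_add, map_sum, modelD_smul, hd, hp, map_sub, hlam,
      Derivation.map_natCast, sub_zero, zero_smul, zero_add, smul_add, ite_smul, one_smul,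
      modelD_modelY d s mu hd hmu _ _ _ (h _), modelD_modelY d s mu hd hmu _ _ _ h0,
      Finset.sum_add_distrib, smul_ite, smul_zero, Finset.sum_ite_eq, Finset.mem_univ, if_true]
    have e : ∀ l : Fin k, n + l + 1 + p + 1 = n + p + 1 + l + 1 := fun l => by omega
    simp only [e]
    push_cast
    module
  exact DFunLike.congr_fun this m

end Model

/-! #### Base change, symbols and the projection to rank `k` -/

section Symbol

variable {k : ℕ} {S : Type} [CommRing S]

/-- Base change of the model along a ring homomorphism. -/
def modelMap {S' : Type} [CommRing S'] (g : S →+* S') : (ℕ →₀ S) →+ (ℕ →₀ S') :=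
  Finsupp.mapRange.addMonoidHom g.toAddMonoidHom

theorem modelMap_apply {S' : Type} [CommRing S'] (g : S →+* S') (m : ℕ →₀ S) (n : ℕ) :
    modelMap g m n = g (m n) := rfl

theorem modelMap_smul {S' : Type} [CommRing S'] (g : S →+* S') (a : S) (m : ℕ →₀ S) :
    modelMap g (a • m) = g a • modelMap g m := by
  ext n
  simp [modelMap_apply]

theorem modelMap_single {S' : Type} [CommRing S'] (g : S →+* S') (n : ℕ) :
    modelMap g (Finsupp.single n 1) = Finsupp.single n 1 := by
  simp [modelMap]

theorem modelMap_modelY {S' : Type} [CommRing S'] (g : S →+* S') (s : Fin k → S) (mu : S)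
    (q n : ℕ) (h : n ≤ k * q) :
    modelMap g (modelY s mu q n) = modelY (fun p => g (s p)) (g mu) q n := by
  induction q, n, h using model_induction with
  | zero => rw [modelY_zero, modelY_zero, modelMap_single]
  | top q n h1 h2 => rw [modelY_of_lt _ _ h1, modelY_of_lt _ _ h1, modelMap_single]
  | step q n h1 h1' h2 h2' h3 =>
    rw [modelY_of_le _ _ h1, modelY_of_le _ _ h1]
    simp only [map_sub, map_neg, map_sum, modelMap_smul, h2', h3, map_add, map_natCast]

/-- The vectors `∑ a_i b_{i+1}`. -/
def modelE (k : ℕ) (S : Type) [CommRing S] : (Fin k → S) →ₗ[S] (ℕ →₀ S) :=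
  Fintype.linearCombination S fun i : Fin k => Finsupp.single ((i : ℕ) + 1) 1

theorem modelE_apply (a : Fin k → S) :
    modelE k S a = ∑ i, a i • Finsupp.single ((i : ℕ) + 1) 1 := rfl

theorem modelMap_modelE {S' : Type} [CommRing S'] (g : S →+* S') (a : Fin k → S) :
    modelMap g (modelE k S a) = modelE k S' (fun i => g (a i)) := by
  simp only [modelE_apply, map_sum, modelMap_smul, modelMap_single]

theorem modelE_apply_succ (a : Fin k → S) (i : Fin k) : modelE k S a (i + 1) = a i := by
  rw [modelE_apply, Finsupp.finsetSum_apply, Finset.sum_eq_single i]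
  · simp
  · intro j _ hj
    have : (j : ℕ) ≠ i := fun h => hj (Fin.ext h)
    rw [Finsupp.smul_apply, Finsupp.single_eq_of_ne (by omega), smul_zero]
  · simp

theorem modelE_apply_of_ne (a : Fin k → S) {n : ℕ} (h : ∀ i : Fin k, n ≠ i + 1) :
    modelE k S a n = 0 := by
  rw [modelE_apply, Finsupp.finsetSum_apply]
  refine Finset.sum_eq_zero fun i _ => ?_
  rw [Finsupp.smul_apply, Finsupp.single_eq_of_ne (h i), smul_zero]

/-- The filtration of the model by the order. -/
def modelF (k : ℕ) (S : Type) [CommRing S] (q : ℕ) : Submodule S (ℕ →₀ S) :=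
  Finsupp.supported S S {i | i ≤ k * q}

theorem mem_modelF {q : ℕ} {m : ℕ →₀ S} : m ∈ modelF k S q ↔ ∀ i, k * q < i → m i = 0 := by
  simp [modelF, Finsupp.mem_supported']

theorem modelF_eq_span (q : ℕ) : modelF k S q =
    Submodule.span S ((fun i => Finsupp.single i 1) '' {i | i ≤ k * q}) :=
  Finsupp.supported_eq_span_single _ _

theorem modelF_mono {q q' : ℕ} (h : q ≤ q') : modelF k S q ≤ modelF k S q' :=
  Finsupp.supported_mono fun _ hi => le_trans hi (Nat.mul_le_mul_left k h)

theorem modelY_mem_modelF (s : Fin k → S) (mu : S) {q n : ℕ} (h : n ≤ k * q) :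
    modelY s mu q n ∈ modelF k S q := mem_modelF.mpr (modelY_apply_of_gt s mu q n h)

/-- The polynomial `z^k + ∑ s_h z^{k-h}`. -/
def symPoly (s : Fin k → S) : Polynomial S :=
  Polynomial.X ^ k + ∑ p : Fin k, Polynomial.C (s p) * Polynomial.X ^ (k - ((p : ℕ) + 1))

theorem degree_symPoly_tail (s : Fin k → S) :
    (∑ p : Fin k, Polynomial.C (s p) * Polynomial.X ^ (k - ((p : ℕ) + 1))).degree <
      ((k : ℕ) : WithBot ℕ) := by
  rw [← Polynomial.mem_degreeLT]
  refine Submodule.sum_mem _ fun p _ => ?_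
  rw [Polynomial.mem_degreeLT]
  refine lt_of_le_of_lt (Polynomial.degree_C_mul_X_pow_le _ _) ?_
  have := p.2
  exact_mod_cast (by omega : k - ((p : ℕ) + 1) < k)

theorem monic_symPoly (s : Fin k → S) : (symPoly s).Monic :=
  Polynomial.monic_X_pow_add (degree_symPoly_tail s)

theorem degree_symPoly [Nontrivial S] (s : Fin k → S) : (symPoly s).degree = k := by
  rw [symPoly, Polynomial.degree_add_eq_left_of_degree_lt, Polynomial.degree_X_pow]
  rw [Polynomial.degree_X_pow]
  exact degree_symPoly_tail s

/-- The ring of symbols `S[z] / (z^k + ∑ s_h z^{k-h})`. -/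
abbrev SymRing (s : Fin k → S) : Type := AdjoinRoot (symPoly s)

/-- The class of `z`. -/
def zeta (s : Fin k → S) : SymRing s := AdjoinRoot.root (symPoly s)

theorem zeta_pow (s : Fin k → S) :
    zeta s ^ k = -∑ p : Fin k, s p • zeta s ^ (k - ((p : ℕ) + 1)) := by
  have h := AdjoinRoot.eval₂_root (symPoly s)
  rw [symPoly, Polynomial.eval₂_add, Polynomial.eval₂_X_pow, Polynomial.eval₂_finsetSum] at h
  rw [eq_neg_iff_add_eq_zero]
  refine Eq.trans ?_ h
  congr 1
  refine Finset.sum_congr rfl fun p _ => ?_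
  rw [Polynomial.eval₂_mul, Polynomial.eval₂_C, Polynomial.eval₂_X_pow, Algebra.smul_def]
  rfl

/-- The symbol of `U_0`. -/
def symU (s : Fin k → S) : SymRing s :=
  ∑ p : Fin k, ((p : ℕ) + 1 : S) • s p • zeta s ^ (k - ((p : ℕ) + 1))

/-- The symbol of order `q + 1`. -/
def sym (s : Fin k → S) (q : ℕ) : (ℕ →₀ S) →ₗ[S] SymRing s :=
  Finsupp.linearCombination S fun n =>
    -- The `k` basis vectors of exact order `q + 1` correspond to the powers `1, z, …, z^(k-1)`, the
    -- heaviest to `1`.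
    if k * q < n ∧ n ≤ k * (q + 1) then zeta s ^ (k * (q + 1) - n) else 0

theorem sym_single (s : Fin k → S) (q n : ℕ) : sym s q (Finsupp.single n 1) =
    if k * q < n ∧ n ≤ k * (q + 1) then zeta s ^ (k * (q + 1) - n) else 0 := by
  rw [sym, Finsupp.linearCombination_single, one_smul]

/-- Presents the symbol by a representative of degree below `k`, so that vanishing can be read off
from coefficients. -/
theorem sym_eq_sum (s : Fin k → S) (q : ℕ) (m : ℕ →₀ S) :
    sym s q m = AdjoinRoot.mk (symPoly s)
      (∑ j ∈ Finset.range k, Polynomial.C (m (k * (q + 1) - j)) * Polynomial.X ^ j) := by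
  have : sym s q m = ∑ j ∈ Finset.range k, m (k * (q + 1) - j) • zeta s ^ j := by
    induction m using Finsupp.induction_linear with
    | zero => simp
    | add f g hf hg => simp [hf, hg, add_smul, Finset.sum_add_distrib]
    | single n a =>
      rw [← mul_one a, ← smul_eq_mul, ← Finsupp.smul_single, map_smul, sym_single]
      split_ifs with h
      · rw [Finset.sum_eq_single (k * (q + 1) - n)]
        · rw [Nat.sub_sub_self h.2]; simp
        · intro j hj hj'
          rw [Finset.mem_range] at hj
          rw [Finsupp.smul_apply, Finsupp.single_eq_of_ne, smul_zero, zero_smul]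
          rw [mul_add] at hj' ⊢
          omega
        · intro h'
          rw [Finset.mem_range] at h'
          rw [mul_add] at h h'
          omega
      · rw [smul_zero, Finset.sum_eq_zero]
        intro j hj
        rw [Finset.mem_range] at hj
        rw [Finsupp.smul_apply, Finsupp.single_eq_of_ne, smul_zero, zero_smul]
        rw [mul_add] at h ⊢
        omega
  rw [this, map_sum]
  refine Finset.sum_congr rfl fun j _ => ?_
  rw [map_mul, map_pow, AdjoinRoot.mk_C, AdjoinRoot.mk_X, Algebra.smul_def]
  rfl

theorem sym_eq_zero_of_mem (s : Fin k → S) {q : ℕ} {m : ℕ →₀ S} (h : m ∈ modelF k S q) :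
    sym s q m = 0 := by
  rw [sym_eq_sum, Finset.sum_eq_zero, map_zero]
  intro j hj
  rw [Finset.mem_range] at hj
  rw [mem_modelF.mp h _ (by rw [mul_add]; omega), map_zero, zero_mul]

/-- A monic polynomial of degree `k` divides no nonzero polynomial of smaller degree. Together with
`exists_sym_eq` this identifies the graded piece of order `q + 1` with `SymRing s`. -/
theorem mem_modelF_of_sym_eq_zero (s : Fin k → S) {q : ℕ} {m : ℕ →₀ S}
    (hm : m ∈ modelF k S (q + 1)) (h : sym s q m = 0) : m ∈ modelF k S q := by
  nontriviality S
  rw [sym_eq_sum, AdjoinRoot.mk_eq_zero] at h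
  have h0 : ∑ j ∈ Finset.range k, Polynomial.C (m (k * (q + 1) - j)) * Polynomial.X ^ j = 0 := by
    by_contra hne
    refine (monic_symPoly s).not_dvd_of_degree_lt hne ?_ h
    rw [degree_symPoly]
    rw [← Polynomial.mem_degreeLT]
    refine Submodule.sum_mem _ fun j hj => ?_
    rw [Polynomial.mem_degreeLT]
    refine lt_of_le_of_lt (Polynomial.degree_C_mul_X_pow_le _ _) ?_
    exact_mod_cast Finset.mem_range.mp hj
  rw [mem_modelF] at hm ⊢
  intro i hi
  by_cases hi' : k * (q + 1) < i
  · exact hm i hi'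
  · have h1 := congrArg (fun p => Polynomial.coeff p (k * (q + 1) - i)) h0
    simp only [Polynomial.finsetSum_coeff, Polynomial.coeff_C_mul_X_pow,
      Polynomial.coeff_zero] at h1
    rw [Finset.sum_ite_eq, if_pos (by
        rw [Finset.mem_range]; rw [mul_add] at hi' ⊢; omega),
      Nat.sub_sub_self (not_lt.mp hi')] at h1
    exact h1

/-- Division with remainder by the monic `symPoly s`. -/
theorem exists_sym_eq (s : Fin k → S) (q : ℕ) (a : SymRing s) :
    ∃ m ∈ modelF k S (q + 1), sym s q m = a := by
  rcases subsingleton_or_nontrivial S with hS | hS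
  · have := Module.subsingleton S (SymRing s)
    exact ⟨0, Submodule.zero_mem _, Subsingleton.elim _ _⟩
  obtain ⟨p, rfl⟩ := AdjoinRoot.mk_surjective a
  have hr : (p %ₘ symPoly s).degree < ((k : ℕ) : WithBot ℕ) := by
    rw [← degree_symPoly s]
    exact Polynomial.degree_modByMonic_lt _ (monic_symPoly s)
  have hmem : ∀ j, Finsupp.single (k * (q + 1) - j) (1 : S) ∈ modelF k S (q + 1) := by
    intro j
    rw [mem_modelF]
    intro i hi
    rw [Finsupp.single_eq_of_ne (by omega)]
  refine ⟨∑ j ∈ Finset.range k, (p %ₘ symPoly s).coeff j • Finsupp.single (k * (q + 1) - j) 1,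
    Submodule.sum_mem _ fun j _ => Submodule.smul_mem _ _ (hmem j), ?_⟩
  have hp : AdjoinRoot.mk (symPoly s) p = AdjoinRoot.mk (symPoly s) (p %ₘ symPoly s) := by
    rw [AdjoinRoot.mk_eq_mk]
    exact ⟨p /ₘ symPoly s, by rw [sub_eq_iff_eq_add', Polynomial.modByMonic_add_div]⟩
  have hs : p %ₘ symPoly s = ∑ j ∈ Finset.range k,
      Polynomial.C ((p %ₘ symPoly s).coeff j) * Polynomial.X ^ j := by
    ext i
    simp only [Polynomial.finsetSum_coeff, Polynomial.coeff_C_mul_X_pow, Finset.sum_ite_eq,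
      Finset.mem_range]
    split_ifs with h
    · rfl
    · exact (Polynomial.degree_lt_iff_coeff_zero _ _).mp hr i (not_lt.mp h)
  rw [hp]
  conv_rhs => rw [hs]
  rw [map_sum, map_sum]
  refine Finset.sum_congr rfl fun j hj => ?_
  rw [Finset.mem_range] at hj
  rw [map_smul, sym_single, if_pos (by rw [mul_add]; omega), Nat.sub_sub_self
    (by rw [mul_add]; omega), map_mul, map_pow, AdjoinRoot.mk_C, AdjoinRoot.mk_X, Algebra.smul_def]
  rfl

/-- In top order the term `(mu + q) y(q, n)` disappears, and the recursion becomes the equation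
`zeta_pow`. -/
theorem sym_modelY (s : Fin k → S) (mu : S) (q n : ℕ) (h : n ≤ k * (q + 1)) :
    sym s q (modelY s mu (q + 1) n) = zeta s ^ (k * (q + 1) - n) := by
  induction hd : k * (q + 1) - n using Nat.strong_induction_on generalizing n with
  | _ d ih =>
    subst hd
    by_cases hn : k * q < n
    · rw [modelY_of_lt s mu hn, sym_single, if_pos ⟨hn, h⟩]
    · have hn' := not_lt.mp hn
      have e : k * (q + 1) - n = (k * q - n) + k := by rw [mul_add]; omega
      rw [modelY_of_le s mu hn', map_sub, map_neg, map_smul,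
        sym_eq_zero_of_mem s (modelY_mem_modelF s mu hn'), smul_zero, sub_zero, map_sum,
        e, pow_add, zeta_pow, mul_neg, Finset.mul_sum]
      refine congrArg _ (Finset.sum_congr rfl fun p _ => ?_)
      have := p.2
      rw [mul_add] at h
      rw [map_smul, ih _ (by rw [mul_add]; omega) _ (by rw [mul_add]; omega) rfl, mul_smul_comm,
        ← pow_add]
      congr 2
      rw [mul_add]
      omega

/-! ### Reduction modulo the image of `U_0 - lam` -/

variable [NeZero k]

theorem modelU_single_mem (s : Fin k → S) (mu lam : S) {q n : ℕ} (h : n ≤ k * q) :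
    modelU s mu lam (Finsupp.single n 1) ∈ modelF k S (q + 1) := by
  rw [modelU_single]
  have hn := le_mul_level (k := k) n
  refine Submodule.add_mem _ (Submodule.sum_mem _ fun p _ => Submodule.smul_mem _ _
    (Submodule.smul_mem _ _ (modelF_mono (Nat.succ_le_succ (level_le h)) (modelY_mem_modelF s mu ?_))))
    (Submodule.smul_mem _ _ ?_)
  · have := p.2
    rw [Nat.mul_succ]; omega
  · rw [mem_modelF]
    intro i hi
    rw [mul_add] at hi
    rw [Finsupp.single_eq_of_ne (by omega)]

theorem modelU_mem (s : Fin k → S) (mu lam : S) {q : ℕ} {m : ℕ →₀ S} (h : m ∈ modelF k S q) :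
    modelU s mu lam m ∈ modelF k S (q + 1) := by
  have : modelF k S q ≤ (modelF k S (q + 1)).comap (modelU s mu lam) := by
    rw [modelF_eq_span, Submodule.span_le]
    rintro _ ⟨n, hn, rfl⟩
    exact modelU_single_mem s mu lam hn
  exact this h

/-- The diagonal part `n - lam` does not raise the order, so only the shifts contribute to the
symbol. -/
theorem sym_modelU (s : Fin k → S) (mu lam : S) {q : ℕ} {m : ℕ →₀ S}
    (h : m ∈ modelF k S (q + 1)) :
    sym s (q + 1) (modelU s mu lam m) = symU s * sym s q m := by
  have : Set.EqOn ((sym s (q + 1)).comp (modelU s mu lam))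
      ((LinearMap.mulLeft S (symU s)).comp (sym s q))
      (Submodule.span S ((fun i => Finsupp.single i (1 : S)) '' {i | i ≤ k * (q + 1)})) := by
    refine LinearMap.eqOn_span ?_
    rintro _ ⟨n, hn, rfl⟩
    change sym s (q + 1) (modelU s mu lam _) = symU s * sym s q _
    rw [sym_single]
    split_ifs with hq
    · have hs : sym s (q + 1) (Finsupp.single n 1) = 0 := by
        rw [sym_single, if_neg (by omega)]
      rw [modelU_single, level_eq hq.1 hq.2, map_add, map_smul, hs, smul_zero, add_zero, map_sum,
        symU, Finset.sum_mul]
      refine Finset.sum_congr rfl fun p _ => ?_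
      have hp := p.2
      have hn2 := hq.2
      rw [map_smul, map_smul, sym_modelY s mu _ _ (by rw [mul_add k (q + 1)]; omega),
        smul_mul_assoc, smul_mul_assoc, ← pow_add]
      congr 3
      rw [mul_add k (q + 1)]
      omega
    · have hq' : n ≤ k * q := by
        by_contra hc
        exact hq ⟨not_le.mp hc, hn⟩
      rw [mul_zero]
      exact sym_eq_zero_of_mem s (modelU_single_mem s mu lam hq')
  rw [modelF_eq_span] at h
  exact this h

theorem modelMap_modelU {S' : Type} [CommRing S'] (g : S →+* S') (s : Fin k → S) (mu lam : S)
    (m : ℕ →₀ S) :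
    modelMap g (modelU s mu lam m) = modelU (fun p => g (s p)) (g mu) (g lam) (modelMap g m) := by
  induction m using Finsupp.induction_linear with
  | zero => simp
  | add f g hf hg => simp only [map_add, hf, hg]
  | single n a =>
    have h : ∀ p : Fin k, n + p + 1 ≤ k * (level k n + 1) := fun p => by
      have := le_mul_level (k := k) n
      have := p.2
      rw [mul_add]; omega
    rw [← mul_one a, ← smul_eq_mul, ← Finsupp.smul_single, map_smul, modelMap_smul, modelMap_smul,
      map_smul, modelMap_single, modelU_single, modelU_single, map_add, map_sum, modelMap_smul,
      modelMap_single, map_sub, map_natCast]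
    simp only [modelMap_smul, modelMap_modelY g s mu _ _ (h _), map_add, map_natCast, map_one]

/-- If `c` is a multiple of the symbol of `U_0`, then modulo the image of `U_0 - lam` every
element becomes of lower order after multiplication with `c`. -/
theorem exists_smul_sub_modelU_mem (s : Fin k → S) (mu lam c : S) {e : SymRing s}
    (he : symU s * e = algebraMap S _ c) {q : ℕ} {m : ℕ →₀ S} (hm : m ∈ modelF k S (q + 2)) :
    ∃ w, c • m - modelU s mu lam w ∈ modelF k S (q + 1) := by
  obtain ⟨w, hw, hw'⟩ := exists_sym_eq s q (e * sym s (q + 1) m)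
  refine ⟨w, mem_modelF_of_sym_eq_zero s (Submodule.sub_mem _ (Submodule.smul_mem _ _ hm)
    (modelU_mem s mu lam hw)) ?_⟩
  rw [map_sub, map_smul, sym_modelU s mu lam hw, hw', ← mul_assoc, he, Algebra.smul_def, sub_self]

/-- The image of `b_0` is `∑ h s_h b_h - lam b_0`; as `lam` is a unit, `b_0` can be traded for a
combination of `b_1, …, b_k`. -/
theorem exists_eq_modelE_add (s : Fin k → S) (mu lam : S) (hl : IsUnit lam) {m : ℕ →₀ S}
    (hm : m ∈ modelF k S 1) : ∃ a w, m = modelE k S a + modelU s mu lam w := by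
  obtain ⟨l, hl⟩ := hl.exists_left_inv
  have h0 : modelU s mu lam (Finsupp.single 0 1) =
      modelE k S (fun p => ((p : ℕ) + 1 : S) * s p) - lam • Finsupp.single 0 1 := by
    rw [modelU_single, level_zero, modelE_apply, Nat.cast_zero, zero_sub, neg_smul, sub_eq_add_neg]
    congr 1
    refine Finset.sum_congr rfl fun p _ => ?_
    rw [modelY_of_lt s mu (by omega), zero_add, smul_smul]
  have hm' : m = m 0 • Finsupp.single 0 1 + modelE k S (fun i => m (i + 1)) := by
    ext n
    rw [mem_modelF] at hm
    rw [Finsupp.add_apply, Finsupp.smul_apply]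
    rcases Nat.eq_zero_or_pos n with rfl | hn
    · rw [modelE_apply_of_ne _ (by omega)]; simp
    · rw [Finsupp.single_eq_of_ne (by omega), smul_zero, zero_add]
      by_cases hk : n ≤ k
      · have := modelE_apply_succ (fun i : Fin k => m (i + 1)) ⟨n - 1, by omega⟩
        simp only [Nat.sub_add_cancel hn] at this
        exact this.symm
      · rw [hm n (by omega), modelE_apply_of_ne]
        intro i
        have := i.2
        omega
  refine ⟨(fun i : Fin k => m (i + 1)) + (m 0 * l) • fun p : Fin k => ((p : ℕ) + 1 : S) * s p,
    -(m 0 * l) • Finsupp.single 0 1, ?_⟩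
  rw [map_smul, h0, map_add, map_smul]
  have hm0 : m 0 = m 0 * l * lam := by rw [mul_assoc, hl, mul_one]
  conv_lhs => rw [hm', hm0]
  module

/-- Each step down in order costs one factor `c`, and no factor is needed to remove `b_0` in order
one. The case `q = 1` is what makes the pole of the connection simple. -/
theorem exists_smul_eq_of_mem (s : Fin k → S) (mu lam c : S) (hl : IsUnit lam) {e : SymRing s}
    (he : symU s * e = algebraMap S _ c) (q : ℕ) {m : ℕ →₀ S} (hm : m ∈ modelF k S (q + 1)) :
    ∃ a w, c ^ q • m = modelE k S a + modelU s mu lam w := by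
  induction q generalizing m with
  | zero =>
    obtain ⟨a, w, h⟩ := exists_eq_modelE_add s mu lam hl hm
    exact ⟨a, w, by rw [pow_zero, one_smul, h]⟩
  | succ q ih =>
    obtain ⟨w, hw⟩ := exists_smul_sub_modelU_mem s mu lam c he hm
    obtain ⟨a, w', h⟩ := ih hw
    refine ⟨a, w' + c ^ q • w, ?_⟩
    rw [map_add, map_smul, ← add_assoc, ← h, smul_sub, sub_add_cancel, smul_smul, pow_succ]

theorem exists_mem_modelF (m : ℕ →₀ S) : ∃ q, m ∈ modelF k S (q + 1) := by
  refine ⟨m.support.sup id, mem_modelF.mpr fun i hi => ?_⟩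
  by_contra h
  have h1 : i ≤ m.support.sup id := Finset.le_sup (f := id) (Finsupp.mem_support_iff.mpr h)
  have h2 : m.support.sup id + 1 ≤ k * (m.support.sup id + 1) :=
    Nat.le_mul_of_pos_left _ (Nat.pos_of_neZero k)
  omega

/-- When `c` is invertible the symbol of `U_0` is a unit, so the top symbol of `w` must vanish as
long as `w` has positive order. This leaves `w` in the span of `b_0`, and the coordinate at `b_0`
reads `lam * w 0 = 0`. -/
theorem eq_zero_of_modelE_add_eq_zero (s : Fin k → S) (mu lam c : S) (hl : IsUnit lam)
    (hc : IsUnit c) {e : SymRing s} (he : symU s * e = algebraMap S _ c) {a : Fin k → S}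
    {w : ℕ →₀ S} (h : modelE k S a + modelU s mu lam w = 0) : a = 0 := by
  have hE : modelE k S a ∈ modelF k S 1 := by
    refine mem_modelF.mpr fun i hi => modelE_apply_of_ne _ fun j => ?_
    have := j.2
    omega
  have hu : IsUnit (symU s) := isUnit_of_mul_isUnit_left (he ▸ hc.map (algebraMap S (SymRing s)))
  have hw : ∀ q, w ∈ modelF k S q → w ∈ modelF k S 0 := by
    intro q
    induction q with
    | zero => exact id
    | succ q ih =>
      intro hq
      refine ih (mem_modelF_of_sym_eq_zero s hq ?_)
      have h1 := sym_modelU s mu lam hq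
      rw [← neg_eq_iff_add_eq_zero.mpr h, map_neg, sym_eq_zero_of_mem s
        (modelF_mono (by omega) hE), neg_zero] at h1
      exact (hu.mul_right_eq_zero).mp h1.symm
  obtain ⟨q, hq⟩ := exists_mem_modelF (k := k) w
  have h0 := mem_modelF.mp (hw _ hq)
  have hw0 : w = w 0 • Finsupp.single 0 1 := by
    ext n
    rcases Nat.eq_zero_or_pos n with rfl | hn
    · simp
    · rw [h0 n (by omega), Finsupp.smul_apply, Finsupp.single_eq_of_ne (by omega), smul_zero]
  have h2 := congrArg (fun m : ℕ →₀ S => m 0) h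
  have h3 := modelU_apply s mu lam w 0 0 (by simp)
  rw [zero_dvd_iff, sub_eq_zero] at h3
  simp only [Finsupp.add_apply, h3, Finsupp.zero_apply, modelE_apply_of_ne a
    (fun i => (Nat.succ_ne_zero i).symm), Nat.cast_zero, zero_sub, zero_add, neg_mul,
    neg_eq_zero] at h2
  rw [hw0, (hl.mul_right_eq_zero).mp h2, zero_smul, map_zero, add_zero] at h
  ext i
  rw [← modelE_apply_succ a i, h]
  rfl

/-- `π` is the projection of the model onto the span of `b_1, …, b_k` along the image of
`U_0 - lam`. -/
def IsModelProj (s : Fin k → S) (mu lam : S) (π : (ℕ →₀ S) →ₗ[S] (Fin k → S)) : Prop :=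
  (∀ m, ∃ w, m = modelE k S (π m) + modelU s mu lam w) ∧
    ∀ a w, π (modelE k S a + modelU s mu lam w) = a

/-- Existence of the decomposition is the reduction of order with `c` inverted; its uniqueness makes
the chosen coefficients linear. -/
theorem exists_isModelProj (s : Fin k → S) (mu lam c : S) (hl : IsUnit lam)
    (hc : IsUnit c) {e : SymRing s} (he : symU s * e = algebraMap S _ c) :
    ∃ π, IsModelProj s mu lam π := by
  have h1 : ∀ m, ∃ a w, m = modelE k S a + modelU s mu lam w := by
    intro m
    obtain ⟨q, hq⟩ := exists_mem_modelF (k := k) m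
    obtain ⟨a, w, h⟩ := exists_smul_eq_of_mem s mu lam c hl he q hq
    obtain ⟨l, hl⟩ := (hc.pow q).exists_left_inv
    exact ⟨l • a, l • w, by rw [map_smul, map_smul, ← smul_add, ← h, smul_smul, hl, one_smul]⟩
  have h2 : ∀ a w a' w', modelE k S a + modelU s mu lam w = modelE k S a' + modelU s mu lam w' →
      a = a' := by
    intro a w a' w' h
    refine sub_eq_zero.mp (eq_zero_of_modelE_add_eq_zero s mu lam c hl hc he (w := w - w') ?_)
    rw [map_sub, map_sub, ← sub_eq_zero.mpr h]
    abel
  choose f g hfg using h1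
  refine ⟨{ toFun := f, map_add' := fun m n => ?_, map_smul' := fun r m => ?_ },
    fun m => ⟨g m, hfg m⟩, fun a w => (h2 _ _ _ _ (hfg _)).symm⟩
  · refine h2 _ (g (m + n)) _ (g m + g n) ?_
    rw [← hfg, map_add, map_add]
    conv_lhs => rw [hfg m, hfg n]
    abel
  · refine h2 _ (g (r • m)) _ (r • g m) ?_
    rw [← hfg, RingHom.id_apply, map_smul, map_smul, ← smul_add, ← hfg]

/-! ### The projection under base change and derivations -/

namespace IsModelProj

variable {s : Fin k → S} {mu lam : S} {π : (ℕ →₀ S) →ₗ[S] (Fin k → S)}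

omit [NeZero k] in
theorem modelU (hπ : IsModelProj s mu lam π) (w : ℕ →₀ S) : π (modelU s mu lam w) = 0 := by
  simpa using hπ.2 0 w

omit [NeZero k] in
theorem modelE (hπ : IsModelProj s mu lam π) (a : Fin k → S) : π (modelE k S a) = a := by
  simpa using hπ.2 a 0

omit [NeZero k] in
theorem surjective (hπ : IsModelProj s mu lam π) : Function.Surjective π := fun a => ⟨_, hπ.modelE a⟩

omit [NeZero k] in
theorem eq_zero_iff (hπ : IsModelProj s mu lam π) (m : ℕ →₀ S) :
    π m = 0 ↔ ∃ w, m = TraceSystem.modelU s mu lam w := by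
  constructor
  · intro h
    obtain ⟨w, hw⟩ := hπ.1 m
    exact ⟨w, by rwa [h, map_zero, zero_add] at hw⟩
  · rintro ⟨w, rfl⟩
    exact hπ.modelU w

theorem map_modelMap {S' : Type} [CommRing S'] (g : S →+* S')
    {π' : (ℕ →₀ S') →ₗ[S'] (Fin k → S')} (hπ : IsModelProj s mu lam π)
    (hπ' : IsModelProj (fun p => g (s p)) (g mu) (g lam) π') (m : ℕ →₀ S) (i : Fin k) :
    π' (modelMap g m) i = g (π m i) := by
  obtain ⟨w, hw⟩ := hπ.1 m
  conv_lhs => rw [hw]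
  rw [map_add, modelMap_modelE, modelMap_modelU, hπ'.2]

/-- Evaluation of the projection from a relation over another ring. -/
theorem apply_of_relation {S' : Type} [CommRing S'] (g : S →+* S')
    {π' : (ℕ →₀ S') →ₗ[S'] (Fin k → S')}
    (hπ' : IsModelProj (fun p => g (s p)) (g mu) (g lam) π') {c : S} {m w : ℕ →₀ S}
    {a : Fin k → S} (h : c • m = TraceSystem.modelE k S a + TraceSystem.modelU s mu lam w) :
    g c • π' (modelMap g m) = fun i => g (a i) := by
  rw [← map_smul, ← modelMap_smul, h, map_add, modelMap_modelE, modelMap_modelU, hπ'.2]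

/-- The derivation preserves the image of `U_0 - lam`, so it descends to the quotient. The `j`-th
column of the connection matrix is the class of `∂_p` applied to the `j`-th basis vector, which has
order two. -/
theorem map_modelD [Algebra ℂ S] (hπ : IsModelProj s mu lam π) (d : Fin k → Derivation ℂ S S)
    (hd : ∀ p q, d p (s q) = if p = q then 1 else 0) (hmu : ∀ p, d p mu = 0)
    (hlam : ∀ p, d p lam = 0) (C : Fin k → Matrix (Fin k) (Fin k) S)
    (hC : ∀ p i j, C p i j = π (modelY s mu 2 ((j : ℕ) + 1 + p + 1)) i) (p : Fin k) (m : ℕ →₀ S) :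
    π (modelD d s mu p m) = covDer d C p (π m) := by
  obtain ⟨w, hw⟩ := hπ.1 m
  conv_lhs => rw [hw]
  rw [map_add, map_add, modelD_modelU d s mu lam hd hmu hlam, hπ.modelU, add_zero, modelE_apply,
    map_sum, map_sum]
  have e : ∀ j : Fin k, π (modelD d s mu p (π m j • Finsupp.single ((j : ℕ) + 1) 1)) =
      d p (π m j) • Pi.single j 1 + π m j • π (modelY s mu 2 ((j : ℕ) + 1 + p + 1)) := by
    intro j
    have hj : level k ((j : ℕ) + 1) = 0 + 1 := level_eq (by omega) (by have := j.2; omega)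
    have hE : TraceSystem.modelE k S (Pi.single j 1) = Finsupp.single ((j : ℕ) + 1) 1 := by
      rw [modelE_apply, Finset.sum_eq_single j] <;> simp +contextual
    rw [modelD_smul, modelD_single, hj, map_add, map_smul, map_smul, ← hE, hπ.modelE]
  rw [Finset.sum_congr rfl fun j _ => e j]
  ext i
  change _ = d p (π m i) + ∑ j, C p i j * π m j
  rw [Finset.sum_apply]
  simp only [Pi.add_apply, Pi.smul_apply, smul_eq_mul, Finset.sum_add_distrib, hC, Pi.single_apply,
    mul_ite, mul_one, mul_zero, Finset.sum_ite_eq, Finset.mem_univ, if_true]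
  refine congrArg _ (Finset.sum_congr rfl fun j _ => mul_comm _ _)

end IsModelProj

end Symbol

/-! ### The polynomial `σ_k Δ` -/

section Hypersurface

open Polynomial

variable {k : ℕ}

theorem univPoly_tail_mem (k : ℕ) : ∑ h : Fin k,
    (C ((-1) ^ ((h : ℕ) + 1) * MvPolynomial.X h) * X ^ (k - ((h : ℕ) + 1)) :
      (MvPolynomial (Fin k) ℂ)[X]) ∈ degreeLT (MvPolynomial (Fin k) ℂ) k := by
  refine Submodule.sum_mem _ fun p _ => ?_
  rw [mem_degreeLT]
  refine lt_of_le_of_lt (degree_C_mul_X_pow_le _ _) ?_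
  have := p.2
  exact_mod_cast (by omega : k - ((p : ℕ) + 1) < k)

theorem monic_univPoly (k : ℕ) : (univPoly k).Monic :=
  monic_X_pow_add (mem_degreeLT.mp (univPoly_tail_mem k))

theorem degree_univPoly (k : ℕ) : (univPoly k).degree = k := by
  rw [univPoly, degree_add_eq_left_of_degree_lt, degree_X_pow]
  rw [degree_X_pow]
  exact mem_degreeLT.mp (univPoly_tail_mem k)

theorem natDegree_univPoly (k : ℕ) : (univPoly k).natDegree = k :=
  natDegree_eq_of_degree_eq_some (degree_univPoly k)

theorem neg_one_pow_mul_self {R : Type*} [CommRing R] (n : ℕ) : (-1 : R) ^ n * (-1) ^ n = 1 := by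
  rw [← mul_pow, neg_mul_neg, one_mul, one_pow]

variable [NeZero k]

/-- The Bézout relation for the resultant of the monic polynomial and its derivative; the sign
relating resultant and discriminant is absorbed into the cofactors. -/
theorem exists_univPoly_mul_add_eq_discr : ∃ a b : (MvPolynomial (Fin k) ℂ)[X],
    univPoly k * a + derivative (univPoly k) * b = C (univPoly k).discr := by
  have hk : 0 < k := Nat.pos_of_neZero k
  have hd : 0 < (univPoly k).degree := by rw [degree_univPoly]; exact_mod_cast hk
  obtain ⟨a, b, _, _, h⟩ := exists_mul_add_mul_eq_C_resultant (m := (univPoly k).natDegree)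
    (n := (univPoly k).natDegree - 1) (univPoly k) (derivative (univPoly k)) le_rfl
    (natDegree_derivative_le _) (Or.inl (by rw [natDegree_univPoly]; omega))
  rw [resultant_deriv hd, (monic_univPoly k).leadingCoeff, mul_one, map_mul, map_pow, map_neg,
    map_one] at h
  have hs : ∀ n : ℕ, ((-1) ^ n * (-1) ^ n : (MvPolynomial (Fin k) ℂ)[X]) = 1 := 
    neg_one_pow_mul_self
  refine ⟨(-1) ^ ((univPoly k).natDegree * ((univPoly k).natDegree - 1) / 2) * a,
    (-1) ^ ((univPoly k).natDegree * ((univPoly k).natDegree - 1) / 2) * b, ?_⟩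
  rw [mul_left_comm, mul_left_comm _ _ b, ← mul_add, h, ← mul_assoc, hs, one_mul]

/-- The constant term of `P_σ` is `± σ_k`, so `σ_k` lies in the ideal `(P_σ, X)`. Multiplying by the
relation for `Δ`, which lies in `(P_σ, P_σ')`, puts `σ_k Δ` into `(P_σ, X P_σ')`. -/
theorem exists_univPoly_mul_add_eq_hypPoly : ∃ a b : (MvPolynomial (Fin k) ℂ)[X],
    univPoly k * a + X * derivative (univPoly k) * b = C (hypPoly k) := by
  have hk : 0 < k := Nat.pos_of_neZero k
  obtain ⟨a, b, h⟩ := exists_univPoly_mul_add_eq_discr (k := k)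
  have h0 : (univPoly k).coeff 0 = (-1) ^ k * MvPolynomial.X ⟨k - 1, Nat.sub_one_lt (NeZero.ne k)⟩ := by
    rw [univPoly, coeff_add, coeff_X_pow, if_neg (by omega), zero_add, finsetSum_coeff,
      Finset.sum_eq_single ⟨k - 1, Nat.sub_one_lt (NeZero.ne k)⟩]
    · rw [coeff_C_mul_X_pow, if_pos (by simp only; omega)]
      simp only
      rw [Nat.sub_add_cancel hk]
    · intro p _ hp
      have h1 : (p : ℕ) ≠ k - 1 := fun h => hp (Fin.ext h)
      have := p.2
      rw [coeff_C_mul_X_pow, if_neg (by omega)]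
    · simp
  have h1 : X * divX (univPoly k) + C ((-1) ^ k * MvPolynomial.X ⟨k - 1, Nat.sub_one_lt (NeZero.ne k)⟩)
      = univPoly k := by
    rw [← h0, X_mul_divX_add]
  have hs : ((-1) ^ k * (-1) ^ k : (MvPolynomial (Fin k) ℂ)[X]) = 1 := 
    neg_one_pow_mul_self k
  rw [map_mul, map_pow, map_neg, map_one] at h1
  refine ⟨(-1) ^ k * C (univPoly k).discr - (-1) ^ k * X * divX (univPoly k) * a,
    -((-1) ^ k * divX (univPoly k) * b), ?_⟩
  rw [hypPoly, map_mul]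
  linear_combination (-(-1) ^ k * X * divX (univPoly k)) * h - C (univPoly k).discr * (-1) ^ k * h1
    + C (MvPolynomial.X ⟨k - 1, Nat.sub_one_lt (NeZero.ne k)⟩) * C (univPoly k).discr * hs

-- Compares signs: `univPoly` carries alternating signs and `symPoly` none, so `P_σ(-z) = (-1)^k
-- Q(z)` with `Q` the polynomial of symbols.
omit [NeZero k] in
theorem neg_one_pow_mul_neg_pow {R : Type*} [CommRing R] (z : R) (p : Fin k) :
    (-1) ^ ((p : ℕ) + 1) * (-z) ^ (k - ((p : ℕ) + 1)) = (-1) ^ k * z ^ (k - ((p : ℕ) + 1)) := by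
  rw [neg_pow z, ← mul_assoc, ← pow_add, Nat.add_sub_of_le p.2]

/-- A holomorphic multiple of the symbol of `U_0` is `σ_k Δ`. -/
theorem exists_symU_mul_eq {S : Type} [CommRing S] (g : MvPolynomial (Fin k) ℂ →+* S) :
    ∃ e : SymRing (fun p => g (MvPolynomial.X p)),
      symU (fun p => g (MvPolynomial.X p)) * e = algebraMap S _ (g (hypPoly k)) := by
  set s : Fin k → S := fun p => g (MvPolynomial.X p) with hs
  let G : MvPolynomial (Fin k) ℂ →+* SymRing s := (algebraMap S (SymRing s)).comp g
  obtain ⟨a, b, h⟩ := exists_univPoly_mul_add_eq_hypPoly (k := k)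
  have hz := zeta_pow s
  -- The root of `univPoly` in the ring of symbols is `-zeta`, because of the alternating signs.
  have h0 : (univPoly k).eval₂ G (-zeta s) = 0 := by
    rw [univPoly, eval₂_add, eval₂_X_pow, eval₂_finsetSum, neg_pow, hz, mul_neg,
      neg_add_eq_zero, Finset.mul_sum]
    refine Finset.sum_congr rfl fun p _ => ?_
    rw [eval₂_mul, eval₂_C, eval₂_X_pow, map_mul, map_pow, map_neg, map_one, mul_right_comm,
      neg_one_pow_mul_neg_pow, Algebra.smul_def]
    change _ = _ * algebraMap S _ (g _)
    ring
  have h1 : (X * derivative (univPoly k)).eval₂ G (-zeta s) = (-1) ^ (k + 1) * symU s := by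
    -- Euler's identity: the term of degree `k - h` is multiplied by `k - h`. At the root only the
    -- part with the factor `h` survives, and that is the symbol of `U_0` up to sign.
    have e : X * derivative (univPoly k) = (k : (MvPolynomial (Fin k) ℂ)[X]) * univPoly k -
        ∑ h : Fin k, C (((h : ℕ) + 1 : MvPolynomial (Fin k) ℂ) *
          ((-1) ^ ((h : ℕ) + 1) * MvPolynomial.X h)) * X ^ (k - ((h : ℕ) + 1)) := by
      have hX : ∀ n : ℕ, X * derivative (X ^ n : (MvPolynomial (Fin k) ℂ)[X]) =
          (n : (MvPolynomial (Fin k) ℂ)[X]) * X ^ n := by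
        intro n
        rcases n with _ | n
        · simp
        · rw [derivative_X_pow, Nat.add_sub_cancel, C_eq_natCast]; ring
      rw [univPoly, derivative_add, mul_add, hX, derivative_sum, Finset.mul_sum, mul_add,
        add_sub_assoc, Finset.mul_sum, ← Finset.sum_sub_distrib]
      congr 1
      refine Finset.sum_congr rfl fun p _ => ?_
      rw [derivative_C_mul, mul_left_comm, hX, Nat.cast_sub p.2]
      simp only [map_mul, map_add, map_natCast, map_one]
      push_cast
      ring
    rw [e, eval₂_sub, eval₂_mul, h0, mul_zero, zero_sub, eval₂_finsetSum, symU, Finset.mul_sum,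
      ← Finset.sum_neg_distrib]
    refine Finset.sum_congr rfl fun p _ => ?_
    rw [eval₂_mul, eval₂_C, eval₂_X_pow, map_mul, map_mul, map_pow, map_neg, map_one, mul_assoc,
      mul_right_comm ((-1) ^ _), neg_one_pow_mul_neg_pow, smul_smul, Algebra.smul_def, pow_succ]
    simp only [map_add, map_mul, map_natCast, map_one]
    change _ = _ * _ * (_ * algebraMap S _ (g _) * _)
    simp only [G, RingHom.comp_apply]
    ring
  have h2 := congrArg (eval₂ G (-zeta s)) h
  rw [eval₂_add, eval₂_mul, h0, zero_mul, zero_add, eval₂_mul, h1, eval₂_C] at h2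
  exact ⟨(-1) ^ (k + 1) * b.eval₂ G (-zeta s), by rw [← mul_assoc, mul_comm (symU s), h2]; rfl⟩

/-- `σ_k Δ` does not vanish identically. -/
theorem exists_eval_hypPoly_ne_zero : ∃ y : Fin k → ℂ, MvPolynomial.eval y (hypPoly k) ≠ 0 := by
  have hk : 0 < k := Nat.pos_of_neZero k
  -- At `σ_k = 1`, all other coordinates zero, the polynomial is `z^k ± 1`, which is separable with
  -- nonzero constant term.
  let y : Fin k → ℂ := fun p => if (p : ℕ) = k - 1 then 1 else 0
  refine ⟨y, ?_⟩
  have hm : (univPoly k).map (MvPolynomial.eval y) = X ^ k + C ((-1) ^ k) := by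
    rw [univPoly, Polynomial.map_add, Polynomial.map_pow, map_X, Polynomial.map_sum,
      Finset.sum_eq_single ⟨k - 1, Nat.sub_one_lt (NeZero.ne k)⟩]
    · simp [y, Nat.sub_add_cancel hk]
    · intro p _ hp
      have h1 : (p : ℕ) ≠ k - 1 := fun h => hp (Fin.ext h)
      simp [y, h1]
    · simp
  rw [hypPoly, map_mul, MvPolynomial.eval_X]
  have hy : y ⟨k - 1, Nat.sub_one_lt (NeZero.ne k)⟩ = 1 := if_pos rfl
  rw [hy, one_mul]
  intro h0
  have hd : 0 < (univPoly k).degree := by rw [degree_univPoly]; exact_mod_cast hk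
  have h1 := congrArg (MvPolynomial.eval y) (resultant_deriv hd)
  rw [map_mul, h0, mul_zero, ← resultant_map_map, ← derivative_map, hm, natDegree_univPoly] at h1
  have hdeg : (X ^ k + C ((-1) ^ k) : ℂ[X]).natDegree = k := natDegree_X_pow_add_C
  have hdeg' : (derivative (X ^ k + C ((-1) ^ k) : ℂ[X])).natDegree = k - 1 := by
    rw [derivative_add, derivative_C, add_zero, derivative_X_pow,
      natDegree_C_mul_X_pow _ _ (by exact_mod_cast hk.ne')]
  have h2 : resultant (X ^ k + C ((-1) ^ k) : ℂ[X]) (derivative (X ^ k + C ((-1) ^ k))) = 0 := by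
    rw [hdeg, hdeg', h1]
  refine (resultant_eq_zero_iff.mp h2).2 ?_
  have hs : (X ^ k - C (-(-1) ^ k) : ℂ[X]).Separable :=
    separable_X_pow_sub_C _ (by exact_mod_cast hk.ne') (by simp)
  rw [map_neg, sub_neg_eq_add] at hs
  exact hs

end Hypersurface

/-! ### Germs -/

section Germs

variable {k : ℕ}

theorem germ_surjective (x : Fin k → ℂ) (a : Stalk x) : ∃ f, AnalyticAt ℂ f x ∧ germ x f = a := by
  obtain ⟨f, rfl⟩ := toStalk_surjective x a
  exact ⟨f.1, f.2, germ_of_mem f⟩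

theorem germ_eq_zero_iff {x : Fin k → ℂ} {f : (Fin k → ℂ) → ℂ} (hf : AnalyticAt ℂ f x) :
    germ x f = 0 ↔ ∀ᶠ y in 𝓝 x, f y = 0 := by
  rw [germ_of_mem (⟨f, hf⟩ : holAt x), ← map_zero (toStalk x), toStalk_eq_iff]
  rfl

instance (x : Fin k → ℂ) : Nontrivial (Stalk x) := by
  refine ⟨⟨1, 0, fun h => ?_⟩⟩
  rw [← map_one (toStalk x), ← map_zero (toStalk x), toStalk_eq_iff] at h
  exact one_ne_zero h.self_of_nhds

/-- The identity theorem on a ball: if `f` is nonzero at some point of it, then `g` vanishes near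
that point, hence on the whole ball. -/
instance (x : Fin k → ℂ) : NoZeroDivisors (Stalk x) := by
  refine ⟨fun {a b} hab => ?_⟩
  obtain ⟨f, hf, rfl⟩ := germ_surjective x a
  obtain ⟨g, hg, rfl⟩ := germ_surjective x b
  rw [← germ_mul hf hg, germ_eq_zero_iff (hf.mul hg)] at hab
  rw [germ_eq_zero_iff hf, germ_eq_zero_iff hg]
  obtain ⟨r, hr, hball⟩ := Metric.eventually_nhds_iff_ball.mp
    ((hf.eventually_analyticAt.and hg.eventually_analyticAt).and hab)
  by_cases h : ∀ y ∈ Metric.ball x r, f y = 0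
  · exact Or.inl (Metric.eventually_nhds_iff_ball.mpr ⟨r, hr, h⟩)
  · push Not at h
    obtain ⟨y, hy, hfy⟩ := h
    have hy0 : g =ᶠ[𝓝 y] 0 := by
      filter_upwards [(hball y hy).1.1.continuousAt.eventually_ne hfy,
        Metric.isOpen_ball.mem_nhds hy] with z hz hz'
      exact (mul_eq_zero.mp (hball z hz').2).resolve_left hz
    have h0 := AnalyticOnNhd.eqOn_zero_of_preconnected_of_eventuallyEq_zero
      (fun z hz => (hball z hz).1.2) (convex_ball x r).isPreconnected hy hy0
    exact Or.inr (Metric.eventually_nhds_iff_ball.mpr ⟨r, hr, fun z hz => h0 hz⟩)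

instance (x : Fin k → ℂ) : IsDomain (Stalk x) := NoZeroDivisors.to_isDomain _

theorem analyticAt_coord (x : Fin k → ℂ) (p : Fin k) : AnalyticAt ℂ (fun y : Fin k → ℂ => y p) x :=
  (ContinuousLinearMap.proj (R := ℂ) (φ := fun _ : Fin k => ℂ) p).analyticAt x

theorem pderivStalk_coord (x : Fin k → ℂ) (p q : Fin k) :
    pderivStalk x p (coord x q) = if p = q then 1 else 0 := by
  rw [coord, pderivStalk_germ x p (analyticAt_coord x q)]
  have h : pderivFun p (fun y : Fin k → ℂ => y q) = fun _ => if p = q then 1 else 0 := by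
    funext y
    have := (ContinuousLinearMap.proj (R := ℂ) (φ := fun _ : Fin k => ℂ) q).fderiv (x := y)
    change fderiv ℂ (fun y : Fin k → ℂ => y q) y = _ at this
    rw [pderivFun, this]
    simp [Pi.single_apply, eq_comm]
  rw [h]
  have h1 := germ_of_mem (x := x) (algebraMap ℂ (holAt x) (if p = q then 1 else 0))
  rw [AlgHom.commutes] at h1
  refine Eq.trans h1 ?_
  split_ifs <;> simp

theorem pderivStalk_comm (x : Fin k → ℂ) (p q : Fin k) (a : Stalk x) :
    pderivStalk x p (pderivStalk x q a) = pderivStalk x q (pderivStalk x p a) := by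
  obtain ⟨f, hf, rfl⟩ := germ_surjective x a
  rw [pderivStalk_germ x q hf, pderivStalk_germ x p hf,
    pderivStalk_germ x p (analyticAt_pderivFun q hf),
    pderivStalk_germ x q (analyticAt_pderivFun p hf)]
  refine germ_eq_of_eventuallyEq (analyticAt_pderivFun p (analyticAt_pderivFun q hf)) ?_
  filter_upwards [hf.eventually_analyticAt] with y hy
  have hs : IsSymmSndFDerivAt ℂ f y := hy.contDiffAt.isSymmSndFDerivAt (n := ⊤) (by simp)
  have h : ∀ v w : Fin k → ℂ, fderiv ℂ (fun z => fderiv ℂ f z v) y w =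
      fderiv ℂ (fderiv ℂ f) y w v := by
    intro v w
    rw [fderiv_clm_apply hy.fderiv.differentiableAt (differentiableAt_const v)]
    simp
  change fderiv ℂ (fun z => fderiv ℂ f z _) y _ = fderiv ℂ (fun z => fderiv ℂ f z _) y _
  rw [h, h, hs.eq]

theorem analyticAt_eval (p : MvPolynomial (Fin k) ℂ) (x : Fin k → ℂ) :
    AnalyticAt ℂ (fun y => MvPolynomial.eval y p) x := by
  induction p using MvPolynomial.induction_on with
  | C a => simpa using analyticAt_const
  | add p q hp hq =>
    simp only [map_add]
    exact hp.add hq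
  | mul_X p i hp =>
    simp only [map_mul, MvPolynomial.eval_X]
    exact hp.mul (analyticAt_coord x i)

theorem germ_eval (x : Fin k → ℂ) (p : MvPolynomial (Fin k) ℂ) :
    germ x (fun y => MvPolynomial.eval y p) = MvPolynomial.aeval (coord x) p := by
  induction p using MvPolynomial.induction_on with
  | C a =>
    have h1 := germ_of_mem (x := x) (algebraMap ℂ (holAt x) a)
    rw [AlgHom.commutes] at h1
    simp only [MvPolynomial.eval_C, MvPolynomial.aeval_C]
    exact h1
  | add p q hp hq =>
    rw [map_add, ← hp, ← hq, ← germ_add (analyticAt_eval p x) (analyticAt_eval q x)]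
    congr 1
    funext y
    simp
  | mul_X p i hp =>
    rw [map_mul, ← hp, MvPolynomial.aeval_X, coord,
      ← germ_mul (analyticAt_eval p x) (analyticAt_coord x i)]
    congr 1
    funext y
    simp

theorem germ_hyp_ne_zero [NeZero k] (x : Fin k → ℂ) : germ x (hyp (k := k)) ≠ 0 := by
  intro h
  rw [germ_eq_zero_iff (f := hyp) (analyticAt_eval _ x)] at h
  obtain ⟨y, hy⟩ := exists_eval_hypPoly_ne_zero (k := k)
  have h0 := AnalyticOnNhd.eq_of_eventuallyEq (f := hyp (k := k)) (g := 0)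
    (fun z _ => analyticAt_eval _ z) (fun z _ => analyticAt_const) (z₀ := x) h
  exact hy (congrFun h0 y)

theorem isUnit_germ {x : Fin k → ℂ} {f : (Fin k → ℂ) → ℂ} (hf : AnalyticAt ℂ f x) (h : f x ≠ 0) :
    IsUnit (germ x f) := by
  refine IsUnit.of_mul_eq_one (germ x f⁻¹) ?_
  have h1 := germ_of_mem (x := x) 1
  rw [map_one] at h1
  rw [← germ_mul hf (hf.inv h), ← h1]
  refine germ_eq_of_eventuallyEq (hf.mul (hf.inv h)) ?_
  filter_upwards [hf.continuousAt.eventually_ne h] with y hy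
  exact mul_inv_cancel₀ hy

end Germs

/-! ### Normal forms of differential operators -/

section NormalForm

variable {k : ℕ}

/-- The ordered monomial `D^α`. -/
def monoOp {A : Type} [Monoid A] (D : Fin k → A) (α : Fin k → ℕ) : A :=
  (List.ofFn fun p => D p ^ α p).prod

theorem prod_ofFn_mul {A : Type} [Monoid A] {n : ℕ} (f g : Fin n → A)
    (h : ∀ i j, Commute (f i) (g j)) :
    (List.ofFn fun i => f i * g i).prod = (List.ofFn f).prod * (List.ofFn g).prod := by
  induction n with
  | zero => simp
  | succ n ih =>
    simp only [List.ofFn_succ, List.prod_cons]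
    rw [ih _ _ fun i j => h _ _]
    have hc : Commute (g 0) (List.ofFn fun i : Fin n => f i.succ).prod := by
      refine Commute.list_prod_right _ _ fun y hy => ?_
      obtain ⟨i, rfl⟩ := (List.mem_ofFn' _ _).mp hy
      exact (h _ _).symm
    rw [mul_assoc, ← mul_assoc (g 0), hc.eq, mul_assoc, mul_assoc]

theorem prod_ofFn_single {A : Type} [Monoid A] {n : ℕ} (D : Fin n → A) (p : Fin n) :
    (List.ofFn fun i => D i ^ (Pi.single p 1 : Fin n → ℕ) i).prod = D p := by
  induction n with
  | zero => exact p.elim0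
  | succ n ih =>
    rw [List.ofFn_succ, List.prod_cons]
    refine Fin.cases ?_ (fun p => ?_) p
    · simp
    · have h := ih (fun i => D i.succ) p
      rw [Pi.single_eq_of_ne (Fin.succ_ne_zero p).symm, pow_zero, one_mul]
      simpa [Pi.single_apply] using h

theorem mul_monoOp {A : Type} [Monoid A] {D : Fin k → A} (hD : ∀ p q, D p * D q = D q * D p)
    (p : Fin k) (α : Fin k → ℕ) : D p * monoOp D α = monoOp D (α + Pi.single p 1) := by
  rw [add_comm]
  simp only [monoOp, Pi.add_apply, pow_add]
  rw [prod_ofFn_mul _ _ fun i j => (Commute.pow_pow (hD i j) _ _), prod_ofFn_single]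

/-- Every ordered monomial is the product along a word. -/
theorem exists_word (α : Fin k → ℕ) :
    ∃ l : List (Fin k), ∀ (A : Type) [Monoid A] (D : Fin k → A), monoOp D α = (l.map D).prod := by
  refine ⟨(List.ofFn fun p => List.replicate (α p) p).flatten, fun A _ D => ?_⟩
  rw [List.map_flatten, List.prod_flatten, List.map_ofFn, List.map_ofFn, monoOp]
  congr 2
  funext p
  simp

theorem monoOp_zero {A : Type} [Monoid A] (D : Fin k → A) : monoOp D 0 = 1 := by
  rw [monoOp]
  refine List.prod_eq_one fun a ha => ?_
  obtain ⟨i, rfl⟩ := (List.mem_ofFn' _ _).mp ha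
  simp

theorem exists_eq_add_single {α : Fin k → ℕ} (h : α ≠ 0) :
    ∃ (β : Fin k → ℕ) (p : Fin k), α = β + Pi.single p 1 := by
  obtain ⟨p, hp⟩ := Function.ne_iff.mp h
  refine ⟨fun i => if i = p then α p - 1 else α i, p, ?_⟩
  funext i
  by_cases hi : i = p
  · subst hi
    simp only [Pi.zero_apply] at hp
    simp
    omega
  · simp [hi]

variable {S : Type} [CommRing S] [Algebra ℂ S]

theorem derivation_aeval (d : Fin k → Derivation ℂ S S) (s : Fin k → S)
    (hd : ∀ p q, d p (s q) = if p = q then 1 else 0) (p : Fin k) (f : MvPolynomial (Fin k) ℂ) :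
    d p (MvPolynomial.aeval s f) = MvPolynomial.aeval s (MvPolynomial.pderiv p f) := by
  induction f using MvPolynomial.induction_on with
  | C a => simp
  | add f g hf hg => simp [hf, hg]
  | mul_X f i hf =>
    rw [map_mul, Derivation.leibniz, Derivation.leibniz, MvPolynomial.aeval_X, hd, hf,
      MvPolynomial.pderiv_X, map_add, smul_eq_mul, smul_eq_mul, smul_eq_mul, smul_eq_mul, map_mul,
      map_mul, MvPolynomial.aeval_X, Pi.single_apply]
    by_cases h : p = i
    · rw [if_pos h, if_pos h.symm, map_one]
    · rw [if_neg h, if_neg (Ne.symm h), map_zero]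

/-- Monomials in the coordinates serve as test functions: `∂^β` kills the monomial with exponent `α`
unless `β ≤ α`, and for `β = α` it leaves a nonzero constant. -/
theorem monoOp_pderiv_monomial (d : Fin k → Derivation ℂ S S) (s : Fin k → S)
    (hd : ∀ p q, d p (s q) = if p = q then 1 else 0)
    (hdd : ∀ p q a, d p (d q a) = d q (d p a)) (α : Fin k →₀ ℕ) (β : Fin k → ℕ) :
    ∃ c : ℂ, (c ≠ 0 ↔ β ≤ α) ∧
      monoOp (fun p => (d p : Module.End ℂ S)) β (MvPolynomial.aeval s (MvPolynomial.monomial α (1 : ℂ))) =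
        MvPolynomial.aeval s (MvPolynomial.monomial (α - Finsupp.equivFunOnFinite.symm β) c) := by
  induction hn : ∑ i, β i generalizing β with
  | zero =>
    have : β = 0 := by
      funext i
      exact (Finset.sum_eq_zero_iff.mp hn) i (Finset.mem_univ i)
    subst this
    refine ⟨1, ⟨fun _ i => Nat.zero_le _, fun _ => one_ne_zero⟩, ?_⟩
    have h0 : (Finsupp.equivFunOnFinite.symm (0 : Fin k → ℕ)) = 0 := by ext; simp
    rw [monoOp_zero, h0, tsub_zero, Module.End.one_apply]
  | succ n ih =>
    have hne : β ≠ 0 := by rintro rfl; simp at hn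
    obtain ⟨γ, p, rfl⟩ := exists_eq_add_single hne
    have hγ : ∑ i, γ i = n := by
      simp only [Pi.add_apply, Finset.sum_add_distrib, Finset.sum_pi_single', Finset.mem_univ,
        if_true] at hn
      omega
    obtain ⟨c, hc, h⟩ := ih γ hγ
    -- By truncated subtraction the new factor is zero exactly when the exponent at `p` is already
    -- used up.
    refine ⟨c * ((α - Finsupp.equivFunOnFinite.symm γ) p : ℕ), ?_, ?_⟩
    · rw [mul_ne_zero_iff, hc, Nat.cast_ne_zero]
      simp only [Finsupp.tsub_apply, Finsupp.equivFunOnFinite_symm_apply_apply, Pi.le_def,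
        Pi.add_apply, Pi.single_apply]
      constructor
      · rintro ⟨h1, h2⟩ i
        have := h1 i
        split_ifs with hi
        · subst hi; omega
        · omega
      · intro h1
        refine ⟨fun i => by have := h1 i; split_ifs at this <;> omega, ?_⟩
        have := h1 p
        simp only [if_true] at this
        omega
    · rw [← mul_monoOp (fun p q => LinearMap.ext fun a => hdd p q a), Module.End.mul_apply, h]
      change d p _ = _
      rw [derivation_aeval d s hd, MvPolynomial.pderiv_monomial]
      congr 3
      ext i
      simp [Finsupp.single_apply, Pi.single_apply, Nat.sub_sub, eq_comm]

/-! ### Normally ordered sums -/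

variable {B : Type} [Ring B] [Algebra ℂ B]

/-- The normally ordered sum `∑ a_α D^α`. -/
def normalSum (m : S →ₐ[ℂ] B) (D : Fin k → B) : ((Fin k → ℕ) →₀ S) →ₗ[ℂ] B :=
  Finsupp.lsum ℂ fun α => (LinearMap.mulRight ℂ (monoOp D α)).comp m.toLinearMap

theorem normalSum_single (m : S →ₐ[ℂ] B) (D : Fin k → B) (α : Fin k → ℕ) (a : S) :
    normalSum m D (Finsupp.single α a) = m a * monoOp D α := by
  simp [normalSum]

theorem normalSum_smul (m : S →ₐ[ℂ] B) (D : Fin k → B) (a : S) (f : (Fin k → ℕ) →₀ S) :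
    normalSum m D (a • f) = m a * normalSum m D f := by
  induction f using Finsupp.induction_linear with
  | zero => simp
  | add f g hf hg => rw [smul_add, map_add, map_add, hf, hg, mul_add]
  | single α b => rw [Finsupp.smul_single, normalSum_single, normalSum_single, smul_eq_mul, map_mul,
      mul_assoc]

/-- Left multiplication with `D_p` on normally ordered sums. -/
def normalDer (d : Fin k → Derivation ℂ S S) (p : Fin k) (f : (Fin k → ℕ) →₀ S) :
    (Fin k → ℕ) →₀ S :=
  Finsupp.mapRange.linearMap (d p : S →ₗ[ℂ] S) f + Finsupp.mapDomain (· + Pi.single p 1) f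

theorem normalSum_normalDer (d : Fin k → Derivation ℂ S S) (m : S →ₐ[ℂ] B) (D : Fin k → B)
    (hD : ∀ p q, D p * D q = D q * D p) (hm : ∀ p a, D p * m a = m a * D p + m (d p a)) (p : Fin k)
    (f : (Fin k → ℕ) →₀ S) : normalSum m D (normalDer d p f) = D p * normalSum m D f := by
  induction f using Finsupp.induction_linear with
  | zero => simp [normalDer]
  | add f g hf hg =>
    rw [map_add, mul_add, ← hf, ← hg, ← map_add]
    congr 1
    simp only [normalDer, map_add, Finsupp.mapDomain_add]
    abel
  | single α a =>
    rw [normalDer, Finsupp.mapDomain_single, map_add, Finsupp.mapRange.linearMap_apply,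
      Finsupp.mapRange_single, normalSum_single, normalSum_single, normalSum_single,
      ← mul_monoOp hD, ← mul_assoc (D p), hm, add_mul, mul_assoc, add_comm]
    rfl

/-- The normally ordered monomials in the derivations of `S` are independent over `S`. -/
theorem normalSum_injective (d : Fin k → Derivation ℂ S S) (s : Fin k → S)
    (hd : ∀ p q, d p (s q) = if p = q then 1 else 0) (hdd : ∀ p q a, d p (d q a) = d q (d p a))
    {f : (Fin k → ℕ) →₀ S}
    (h : normalSum (Algebra.lmul ℂ S) (fun p => (d p : Module.End ℂ S)) f = 0) : f = 0 := by
  by_contra hf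
  -- Take `α` of least order in the support and test on the monomial with exponent `α`. Another `β`
  -- in the support would need `β ≤ α` to contribute, and minimality then forces `β = α`.
  obtain ⟨α, hα, hmin⟩ := Finset.exists_min_image f.support (fun α => ∑ i, α i)
    (Finsupp.support_nonempty_iff.mpr hf)
  have h1 := congrArg (fun P : Module.End ℂ S => P (MvPolynomial.aeval s
    (MvPolynomial.monomial (Finsupp.equivFunOnFinite.symm α) (1 : ℂ)))) h
  simp only [normalSum, Finsupp.lsum_apply, Finsupp.sum, LinearMap.sum_apply,
    LinearMap.zero_apply] at h1
  rw [Finset.sum_eq_single α] at h1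
  · obtain ⟨c, hc, he⟩ := monoOp_pderiv_monomial d s hd hdd (Finsupp.equivFunOnFinite.symm α) α
    have hc' : c ≠ 0 := hc.mpr le_rfl
    change f α * monoOp (fun p => (d p : Module.End ℂ S)) α _ = 0 at h1
    rw [he, tsub_self, MvPolynomial.aeval_monomial, Finsupp.prod_zero_index, mul_one] at h1
    have hu : IsUnit (algebraMap ℂ S c) := (Ne.isUnit hc').map _
    exact Finsupp.mem_support_iff.mp hα ((hu.mul_left_eq_zero).mp h1)
  · intro β hβ hne
    obtain ⟨c, hc, he⟩ := monoOp_pderiv_monomial d s hd hdd (Finsupp.equivFunOnFinite.symm α) β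
    have hc' : c = 0 := by
      by_contra h0
      have hle : β ≤ α := hc.mp h0
      refine hne (le_antisymm hle fun i => ?_)
      by_contra hi
      exact (hmin β hβ).not_gt (Finset.sum_lt_sum (fun i _ => hle i)
        ⟨i, Finset.mem_univ i, not_le.mp hi⟩)
    change f β * monoOp (fun p => (d p : Module.End ℂ S)) β _ = 0
    rw [he, hc', map_zero, map_zero, mul_zero]
  · intro h0
    exact absurd hα h0

end NormalForm

/-! ### The universal property of the ring of differential operators -/

section DiffOps

variable {k : ℕ}

theorem normalSum_comp {S B B' : Type} [CommRing S] [Algebra ℂ S] [Ring B] [Algebra ℂ B] [Ring B']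
    [Algebra ℂ B'] (g : B →ₐ[ℂ] B') (m : S →ₐ[ℂ] B) (D : Fin k → B) (f : (Fin k → ℕ) →₀ S) :
    g (normalSum m D f) = normalSum (g.comp m) (fun p => g (D p)) f := by
  induction f using Finsupp.induction_linear with
  | zero => simp
  | add f g hf hg => simp only [map_add, hf, hg]
  | single α a =>
    obtain ⟨l, hl⟩ := exists_word α
    rw [normalSum_single, normalSum_single, map_mul, hl, hl, map_list_prod, List.map_map]
    rfl

/-- A differential operator as an operator on germs. -/
def opVal (x : Fin k → ℂ) : DiffOp x →ₐ[ℂ] Module.End ℂ (Stalk x) := (diffOps x).val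

theorem opVal_injective (x : Fin k → ℂ) : Function.Injective (opVal x) := Subtype.val_injective

/-- Multiplications by germs as differential operators. -/
def mulHom (x : Fin k → ℂ) : Stalk x →ₐ[ℂ] DiffOp x :=
  ((Algebra.lmul ℂ (Stalk x)).codRestrict (diffOps x)
    fun f => Algebra.subset_adjoin (Or.inl ⟨f, rfl⟩) : Stalk x →ₐ[ℂ] diffOps x)

theorem dOp_comm (x : Fin k → ℂ) (p q : Fin k) : dOp x p * dOp x q = dOp x q * dOp x p := by
  refine opVal_injective x (LinearMap.ext fun a => ?_)
  rw [map_mul, map_mul]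
  exact pderivStalk_comm x p q a

theorem dOp_mul_mulOp {x : Fin k → ℂ} (p : Fin k) (a : Stalk x) :
    dOp x p * mulOp a = mulOp a * dOp x p + mulOp (pderivStalk x p a) := by
  refine opVal_injective x (LinearMap.ext fun b => ?_)
  rw [map_add, map_mul, map_mul]
  change pderivStalk x p (a * b) = a * pderivStalk x p b + pderivStalk x p a * b
  rw [Derivation.leibniz, smul_eq_mul, smul_eq_mul, mul_comm b]

theorem DiffOp.induction {x : Fin k → ℂ} {P : DiffOp x → Prop} (mulOp : ∀ f, P (mulOp f))
    (dOp : ∀ p, P (dOp x p)) (add : ∀ Q R, P Q → P R → P (Q + R))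
    (mul : ∀ Q R, P Q → P R → P (Q * R)) (Q : DiffOp x) : P Q := by
  have h : ∀ (R : Module.End ℂ (Stalk x)) (hR : R ∈ diffOps x), P (⟨R, hR⟩ : diffOps x) := by
    intro R hR
    induction hR using Algebra.adjoin_induction with
    | mem R hR =>
      rcases hR with ⟨f, rfl⟩ | ⟨p, rfl⟩
      · exact mulOp f
      · exact dOp p
    | algebraMap c =>
      have : TraceSystem.mulOp (algebraMap ℂ (Stalk x) c) = algebraMap ℂ (DiffOp x) c :=
        (mulHom x).commutes c
      have h1 := mulOp (algebraMap ℂ (Stalk x) c)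
      rw [this] at h1
      exact h1
    | add R R' hR hR' h h' => exact add _ _ h h'
    | mul R R' hR hR' h h' => exact mul _ _ h h'
  exact h Q.1 Q.2

/-- The normally ordered form of a differential operator. -/
def normalForm (x : Fin k → ℂ) : ((Fin k → ℕ) →₀ Stalk x) →ₗ[ℂ] DiffOp x :=
  normalSum (mulHom x) (dOp x)

theorem normalForm_injective (x : Fin k → ℂ) : Function.Injective (normalForm x) := by
  refine (injective_iff_map_eq_zero _).mpr fun f hf => ?_
  refine normalSum_injective (pderivStalk x) (coord x) (pderivStalk_coord x)
    (pderivStalk_comm x) ?_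
  have h := congrArg (opVal x) hf
  rw [normalForm, normalSum_comp, map_zero] at h
  exact h

theorem one_eq_normalForm (x : Fin k → ℂ) : normalForm x (Finsupp.single 0 1) = 1 := by
  rw [normalForm, normalSum_single, map_one, monoOp_zero, one_mul]

/-- The normally ordered sums contain `1` and are stable under left multiplication by the
generators. -/
theorem normalForm_surjective (x : Fin k → ℂ) : Function.Surjective (normalForm x) := by
  have h : ∀ (Q : DiffOp x) f, ∃ f', normalForm x f' = Q * normalForm x f := by
    intro Q
    induction Q using DiffOp.induction with
    | mulOp a => exact fun f => ⟨a • f, normalSum_smul _ _ a f⟩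
    | dOp p => exact fun f => ⟨normalDer (pderivStalk x) p f,
        normalSum_normalDer _ _ _ (dOp_comm x) dOp_mul_mulOp p f⟩
    | add Q R hQ hR =>
      intro f
      obtain ⟨a, ha⟩ := hQ f
      obtain ⟨b, hb⟩ := hR f
      exact ⟨a + b, by rw [map_add, ha, hb, add_mul]⟩
    | mul Q R hQ hR =>
      intro f
      obtain ⟨b, hb⟩ := hR f
      obtain ⟨a, ha⟩ := hQ b
      exact ⟨a, by rw [ha, hb, mul_assoc]⟩
  intro Q
  obtain ⟨f, hf⟩ := h Q (Finsupp.single 0 1)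
  exact ⟨f, by rw [hf, one_eq_normalForm, mul_one]⟩

/-- The universal property of `𝒟_{N,x}`. -/
theorem DiffOp.exists_lift {x : Fin k → ℂ} {B : Type} [Ring B] [Algebra ℂ B]
    (m : Stalk x →ₐ[ℂ] B) (D : Fin k → B) (hD : ∀ p q, D p * D q = D q * D p)
    (hm : ∀ p a, D p * m a = m a * D p + m (pderivStalk x p a)) :
    ∃ ρ : DiffOp x →ₐ[ℂ] B, (∀ a, ρ (mulOp a) = m a) ∧ ∀ p, ρ (dOp x p) = D p := by
  let e := LinearEquiv.ofBijective (normalForm x)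
    ⟨normalForm_injective x, normalForm_surjective x⟩
  let ρ : DiffOp x →ₗ[ℂ] B := normalSum m D ∘ₗ e.symm.toLinearMap
  have he : ∀ f, ρ (normalForm x f) = normalSum m D f := fun f =>
    congrArg (normalSum m D) (e.symm_apply_apply f)
  have hmul : ∀ a P, ρ (mulOp a * P) = m a * ρ P := by
    intro a P
    obtain ⟨f, rfl⟩ := normalForm_surjective x P
    rw [he, ← normalSum_smul, ← he]
    exact congrArg ρ (normalSum_smul (mulHom x) (dOp x) a f).symm
  have hder : ∀ p P, ρ (dOp x p * P) = D p * ρ P := by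
    intro p P
    obtain ⟨f, rfl⟩ := normalForm_surjective x P
    rw [he, ← normalSum_normalDer _ m D hD hm, ← he]
    exact congrArg ρ (normalSum_normalDer _ _ _ (dOp_comm x) dOp_mul_mulOp p f).symm
  have h1 : ρ 1 = 1 := by
    rw [← one_eq_normalForm, he, normalSum_single, map_one, monoOp_zero, one_mul]
  -- The existence of some `b` passes to sums and products of operators; putting `P = 1` then shows
  -- `b = ρ Q`, which is multiplicativity.
  have h : ∀ Q, ∃ b, ∀ P, ρ (Q * P) = b * ρ P := by
    intro Q
    induction Q using DiffOp.induction with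
    | mulOp a => exact ⟨m a, hmul a⟩
    | dOp p => exact ⟨D p, hder p⟩
    | add Q R hQ hR =>
      obtain ⟨a, ha⟩ := hQ
      obtain ⟨b, hb⟩ := hR
      exact ⟨a + b, fun P => by rw [add_mul, map_add, ha, hb, add_mul]⟩
    | mul Q R hQ hR =>
      obtain ⟨a, ha⟩ := hQ
      obtain ⟨b, hb⟩ := hR
      exact ⟨a * b, fun P => by rw [mul_assoc, ha, hb, mul_assoc]⟩
  have hρ : ∀ Q P, ρ (Q * P) = ρ Q * ρ P := by
    intro Q P
    obtain ⟨b, hb⟩ := h Q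
    have h2 := hb 1
    rw [mul_one, h1, mul_one] at h2
    rw [hb, h2]
  refine ⟨AlgHom.ofLinearMap ρ h1 hρ, fun a => ?_, fun p => ?_⟩
  · have := hmul a 1
    rwa [mul_one, h1, mul_one] at this
  · have := hder p 1
    rwa [mul_one, h1, mul_one] at this

end DiffOps

/-! ### The relations modulo the left ideals -/

section Words

variable {k : ℕ}

/-- The product of the `∂_p` along a word. -/
def wordOp (x : Fin k → ℂ) (l : List (Fin k)) : DiffOp x := (l.map (dOp x)).prod

/-- The weight of a word. -/
def weight (l : List (Fin k)) : ℕ := (l.map fun p : Fin k => (p : ℕ) + 1).sum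

theorem wordOp_cons (x : Fin k → ℂ) (p : Fin k) (l : List (Fin k)) :
    wordOp x (p :: l) = dOp x p * wordOp x l := by
  rw [wordOp, List.map_cons, List.prod_cons]; rfl

theorem weight_cons (p : Fin k) (l : List (Fin k)) : weight (p :: l) = p + 1 + weight l := by
  rw [weight, List.map_cons, List.sum_cons]; rfl

theorem wordOp_perm (x : Fin k → ℂ) {l l' : List (Fin k)} (h : l.Perm l') :
    wordOp x l = wordOp x l' := by
  refine (h.map _).prod_eq' ?_
  rw [List.pairwise_map]
  exact List.pairwise_of_forall (dOp_comm x)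

theorem weight_perm {l l' : List (Fin k)} (h : l.Perm l') : weight l = weight l' :=
  (h.map _).sum_eq

theorem dOp_mul_wordOp (x : Fin k → ℂ) (p : Fin k) (l : List (Fin k)) :
    dOp x p * wordOp x l = wordOp x l * dOp x p := by
  rw [wordOp]
  refine Commute.list_prod_right _ _ fun y hy => ?_
  obtain ⟨i, _, rfl⟩ := List.mem_map.mp hy
  exact dOp_comm x p i

theorem length_le_weight (l : List (Fin k)) : l.length ≤ weight l := by
  induction l with
  | nil => exact Nat.zero_le _
  | cons p l ih => rw [weight_cons, List.length_cons]; omega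

theorem weight_le (l : List (Fin k)) : weight l ≤ k * l.length := by
  induction l with
  | nil => exact Nat.zero_le _
  | cons p l ih =>
    have := p.2
    rw [weight_cons, List.length_cons, mul_add]; omega

/-- A word whose weight exceeds its length can be brought into the form `p :: l` with `p > 0`. -/
theorem exists_perm_cons {l : List (Fin k)} (h : l.length < weight l) :
    ∃ p t, l.Perm (p :: t) ∧ 0 < (p : ℕ) := by
  by_contra hc
  push Not at hc
  have h0 : ∀ p ∈ l, (p : ℕ) = 0 := fun p hp => by
    have := hc p _ (List.perm_cons_erase hp)
    omega
  have : weight l = l.length := by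
    clear h hc
    induction l with
    | nil => rfl
    | cons p l ih =>
      rw [weight_cons, List.length_cons, ih fun q hq => h0 q (List.mem_cons_of_mem _ hq),
        h0 p List.mem_cons_self]
      omega
  omega

theorem exists_word_of_weight [NeZero k] (q n : ℕ) (h : q ≤ n) (h' : n ≤ k * q) :
    ∃ l : List (Fin k), l.length = q ∧ weight l = n := by
  have hk : 0 < k := Nat.pos_of_neZero k
  induction q generalizing n with
  | zero =>
    obtain rfl : n = 0 := by simpa using h'
    exact ⟨[], rfl, rfl⟩
  | succ q ih =>
    rw [mul_add] at h'
    -- The first letter takes as much weight as possible, at most `k`, while leaving at least one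
    -- unit for each of the `q` remaining letters.
    obtain ⟨w, hw, hwk, h1, h2⟩ : ∃ w, 0 < w ∧ w ≤ k ∧ q + w ≤ n ∧ n - w ≤ k * q := by
      have hkq : q ≤ k * q := Nat.le_mul_of_pos_left q hk
      by_cases hc : n - q ≤ k
      · exact ⟨n - q, by omega, hc, by omega, by omega⟩
      · exact ⟨k, hk, le_rfl, by omega, by omega⟩
    obtain ⟨l, hl, hl'⟩ := ih (n - w) (by omega) h2
    refine ⟨⟨w - 1, by omega⟩ :: l, by rw [List.length_cons, hl], ?_⟩
    rw [weight_cons, hl']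
    simp only
    omega

/-- Modulo `𝒜`, the product along a word depends only on its length and weight. -/
theorem wordOp_sub_mem (x : Fin k → ℂ) (l l' : List (Fin k)) (h : l.length = l'.length)
    (hw : weight l = weight l') : wordOp x l - wordOp x l' ∈ idealA x := by
  induction hn : l.length generalizing l l' with
  | zero =>
    obtain rfl := List.length_eq_zero_iff.mp hn
    obtain rfl := List.length_eq_zero_iff.mp h.symm
    rw [sub_self]
    exact Submodule.zero_mem _
  | succ n ih =>
    -- Induction on the difference `d` of the first letters. When they agree, the tails are compared
    -- by the induction on the length.
    have key : ∀ (d : ℕ) (i j : Fin k) (s s' : List (Fin k)), s.length = n → s'.length = n →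
        weight (i :: s) = weight (j :: s') → (j : ℕ) = i + d →
        wordOp x (i :: s) - wordOp x (j :: s') ∈ idealA x := by
      intro d
      induction d with
      | zero =>
        intro i j s s' hs hs' hw hij
        obtain rfl : i = j := Fin.ext (by omega)
        rw [weight_cons, weight_cons] at hw
        rw [wordOp_cons, wordOp_cons, ← mul_sub]
        exact Submodule.smul_mem _ _ (ih s s' (hs.trans hs'.symm) (by omega) hs)
      | succ d ihd =>
        intro i j s s' hs hs' hw hij
        have hl := length_le_weight s'
        have hw' := hw
        rw [weight_cons, weight_cons] at hw'
        -- Since `i < j` and the total weights agree, the tail `s` is heavier than its length. So it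
        -- has a letter that can be lowered while `i` is raised, by one generator of `𝒜`.
        obtain ⟨m, t, hp, hm⟩ := exists_perm_cons (l := s) (by omega)
        have hj := j.2
        let i' : Fin k := ⟨i + 1, by omega⟩
        let m' : Fin k := ⟨m - 1, by omega⟩
        have hp1 := weight_perm hp
        have hp2 := hp.length_eq
        rw [weight_cons] at hp1
        rw [List.length_cons] at hp2
        have h1 := ihd i' j (m' :: t) s' (by rw [List.length_cons]; omega) hs'
          (by rw [weight_cons, weight_cons, weight_cons]; simp only [i', m']; omega)
          (by simp only [i']; omega)
        have h2 : wordOp x (i :: s) - wordOp x (i' :: m' :: t) ∈ idealA x := by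
          have e : wordOp x (i :: s) - wordOp x (i' :: m' :: t) =
              wordOp x t • (dOp x i * dOp x m - dOp x i' * dOp x m') := by
            rw [wordOp_cons, wordOp_perm x hp, wordOp_cons, wordOp_cons, wordOp_cons, smul_eq_mul,
              mul_sub, dOp_mul_wordOp, dOp_mul_wordOp, ← mul_assoc, ← mul_assoc, dOp_mul_wordOp,
              dOp_mul_wordOp, mul_assoc, mul_assoc]
          rw [e]
          exact Submodule.smul_mem _ _ (Submodule.subset_span
            ⟨i, m, i', m', rfl, by simp only [m']; omega, rfl⟩)
        have := Submodule.add_mem _ h2 h1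
        rwa [sub_add_sub_cancel] at this
    obtain ⟨i, s, rfl⟩ := List.exists_cons_of_length_eq_add_one hn
    obtain ⟨j, s', rfl⟩ := List.exists_cons_of_length_eq_add_one (h ▸ hn)
    simp only [List.length_cons, Nat.add_right_cancel_iff] at h hn
    rcases le_total (i : ℕ) j with hij | hij
    · exact key (j - i) i j s s' hn (h ▸ hn) hw (by omega)
    · rw [← neg_sub]
      exact Submodule.neg_mem _ (key (i - j) j i s' s (h ▸ hn) hn hw.symm (by omega))

end Words

/-! ### The model as a module over the differential operators -/

section Action

variable {k : ℕ} [NeZero k]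

theorem exists_modelAction (μ : ℂ) (x : Fin k → ℂ) :
    ∃ ρ : DiffOp x →ₐ[ℂ] Module.End ℂ (ℕ →₀ Stalk x), (∀ a m, ρ (mulOp a) m = a • m) ∧
      ∀ p, ρ (dOp x p) = modelD (pderivStalk x) (coord x) (algebraMap ℂ (Stalk x) μ) p := by
  obtain ⟨ρ, h, h'⟩ := DiffOp.exists_lift (x := x)
    (Algebra.lsmul ℂ ℂ (ℕ →₀ Stalk x))
    (modelD (pderivStalk x) (coord x) (algebraMap ℂ (Stalk x) μ))
    (modelD_comm _ _ _ (pderivStalk_coord x) (fun p => (pderivStalk x p).map_algebraMap μ)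
      (pderivStalk_comm x))
    (fun p a => LinearMap.ext fun m => by
      rw [LinearMap.add_apply, Module.End.mul_apply, Module.End.mul_apply, add_comm]
      exact modelD_smul _ _ _ p a m)
  exact ⟨ρ, fun a m => by rw [h]; rfl, h'⟩

/-- The `𝒟_{N,x}`-module structure of the model of `𝒟_N / ℐ_μ`. -/
def modelAction (μ : ℂ) (x : Fin k → ℂ) : DiffOp x →ₐ[ℂ] Module.End ℂ (ℕ →₀ Stalk x) :=
  (exists_modelAction μ x).choose

variable (μ lam : ℂ) {x : Fin k → ℂ}

theorem modelAction_mulOp (a : Stalk x) (m : ℕ →₀ Stalk x) :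
    modelAction μ x (mulOp a) m = a • m := (exists_modelAction μ x).choose_spec.1 a m

theorem modelAction_dOp (p : Fin k) : modelAction μ x (dOp x p) =
    modelD (pderivStalk x) (coord x) (algebraMap ℂ (Stalk x) μ) p :=
  (exists_modelAction μ x).choose_spec.2 p

/-- The classes of the monomials `∂^α` in the model at `x`. -/
abbrev stalkY (μ : ℂ) (x : Fin k → ℂ) (q n : ℕ) : ℕ →₀ Stalk x :=
  modelY (coord x) (algebraMap ℂ (Stalk x) μ) q n

/-- Right multiplication with `U_0 - lam` in the model at `x`. -/
abbrev stalkU (μ lam : ℂ) (x : Fin k → ℂ) : (ℕ →₀ Stalk x) →ₗ[Stalk x] (ℕ →₀ Stalk x) :=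
  modelU (coord x) (algebraMap ℂ (Stalk x) μ) (algebraMap ℂ (Stalk x) lam)

theorem modelAction_dOp_stalkY (p : Fin k) {q n : ℕ} (h : n ≤ k * q) :
    modelAction μ x (dOp x p) (stalkY μ x q n) = stalkY μ x (q + 1) (n + p + 1) := by
  rw [modelAction_dOp]
  exact modelD_modelY _ _ _ (pderivStalk_coord x) (fun p => (pderivStalk x p).map_algebraMap μ)
    p q n h

theorem modelAction_stalkU (P : DiffOp x) (m : ℕ →₀ Stalk x) :
    modelAction μ x P (stalkU μ lam x m) = stalkU μ lam x (modelAction μ x P m) := by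
  induction P using DiffOp.induction generalizing m with
  | mulOp a => rw [modelAction_mulOp, modelAction_mulOp, map_smul]
  | dOp p =>
    rw [modelAction_dOp]
    exact modelD_modelU _ _ _ _ (pderivStalk_coord x)
      (fun p => (pderivStalk x p).map_algebraMap μ)
      (fun p => (pderivStalk x p).map_algebraMap lam) p m
  | add Q R hQ hR => rw [map_add, LinearMap.add_apply, LinearMap.add_apply, hQ, hR, map_add]
  | mul Q R hQ hR => rw [map_mul, Module.End.mul_apply, Module.End.mul_apply, hR, hQ]

theorem modelAction_wordOp (l : List (Fin k)) :
    modelAction μ x (wordOp x l) (stalkY μ x 0 0) = stalkY μ x l.length (weight l) := by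
  induction l with
  | nil =>
    have : wordOp x [] = 1 := rfl
    rw [this, map_one]; rfl
  | cons p l ih =>
    rw [wordOp_cons, map_mul, Module.End.mul_apply, ih, modelAction_dOp_stalkY μ p (weight_le l),
      weight_cons, List.length_cons]
    congr 1
    omega

theorem modelAction_opE : modelAction μ x (opE x) (stalkY μ x 0 0) =
    ∑ p, coord x p • stalkY μ x 1 (p + 1) := by
  rw [opE, map_sum, LinearMap.sum_apply]
  refine Finset.sum_congr rfl fun p _ => ?_
  rw [map_mul, Module.End.mul_apply, modelAction_mulOp, modelAction_dOp_stalkY μ p (Nat.zero_le _),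
    zero_add, zero_add]

omit [NeZero k] in
theorem algebraMap_smul_model (c : ℂ) (m : ℕ →₀ Stalk x) :
    algebraMap ℂ (Stalk x) c • m = c • m := algebraMap_smul _ c m

theorem modelAction_opU0 :
    modelAction μ x (opU0 x - algebraMap ℂ (DiffOp x) lam) (stalkY μ x 0 0) =
      stalkU μ lam x (stalkY μ x 0 0) := by
  rw [modelU_modelY _ _ _ _ _ (Nat.zero_le _), map_sub, LinearMap.sub_apply, opU0, map_sum,
    LinearMap.sum_apply, AlgHom.commutes, Nat.cast_zero, zero_sub, neg_smul, ← sub_eq_add_neg,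
    algebraMap_smul_model]
  congr 1
  refine Finset.sum_congr rfl fun p _ => ?_
  rw [map_smul, LinearMap.smul_apply, map_mul, Module.End.mul_apply, modelAction_mulOp,
    modelAction_dOp_stalkY μ p (Nat.zero_le _), zero_add, ← algebraMap_smul_model, map_add,
    map_natCast, map_one]

/-- The annihilator of `b_0` is a left ideal, so only generators matter. Those of `𝒜` are
differences of words of equal length and weight; each of the others gives one instance of the
recursion in order two. -/
theorem modelAction_eq_zero {P : DiffOp x} (h : P ∈ idealI μ x) :
    modelAction μ x P (stalkY μ x 0 0) = 0 := by
  let K : Submodule (DiffOp x) (DiffOp x) :=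
    { carrier := {P | modelAction μ x P (stalkY μ x 0 0) = 0}
      add_mem' := fun {a b} ha hb => by
        change modelAction μ x (a + b) (stalkY μ x 0 0) = 0
        rw [map_add, LinearMap.add_apply, Set.mem_ofPred.mp ha, Set.mem_ofPred.mp hb, add_zero]
      zero_mem' := by
        change modelAction μ x 0 (stalkY μ x 0 0) = 0
        rw [map_zero, LinearMap.zero_apply]
      smul_mem' := fun c a ha => by
        change modelAction μ x (c * a) (stalkY μ x 0 0) = 0
        rw [map_mul, Module.End.mul_apply, Set.mem_ofPred.mp ha, map_zero] }
  have hI : idealI μ x ≤ K := by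
    refine sup_le (Submodule.span_le.mpr ?_) (Submodule.span_le.mpr ?_)
    · rintro _ ⟨i, j, i', j', hi, hj, rfl⟩
      change modelAction μ x _ (stalkY μ x 0 0) = 0
      have h1 := modelAction_wordOp μ (x := x) [i, j]
      have h2 := modelAction_wordOp μ (x := x) [i', j']
      have e : ∀ i j : Fin k, wordOp x [i, j] = dOp x i * dOp x j := fun i j => by
        simp [wordOp]
      rw [e] at h1 h2
      rw [map_sub, LinearMap.sub_apply, h1, h2, sub_eq_zero]
      congr 1
      simp only [weight, List.map_cons, List.sum_cons]
      omega
    · rintro _ ⟨m', m, hm, rfl⟩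
      change modelAction μ x _ (stalkY μ x 0 0) = 0
      have h1 := modelAction_wordOp μ (x := x) [0, m']
      have e : wordOp x [0, m'] = dOp x 0 * dOp x m' := by simp [wordOp]
      rw [e] at h1
      have hw : weight [0, m'] = m + 1 := by
        simp only [weight, List.map_cons, List.sum_cons, List.map_nil, List.sum_nil, Fin.val_zero]
        omega
      have hk : (m : ℕ) + 1 ≤ k * 1 := by have := m.2; omega
      rw [map_add, LinearMap.add_apply, h1, map_mul, Module.End.mul_apply, map_add,
        LinearMap.add_apply, modelAction_opE, AlgHom.commutes, map_add, map_sum, hw]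
      have h3 : ∀ p : Fin k, modelAction μ x (dOp x m) (coord x p • stalkY μ x 1 (p + 1)) =
          (if m = p then (1 : Stalk x) else 0) • stalkY μ x 1 (p + 1) +
            coord x p • stalkY μ x 2 (m + 1 + p + 1) := by
        intro p
        have hp : (p : ℕ) + 1 ≤ k * 1 := by have := p.2; omega
        have h4 := modelAction_dOp_stalkY μ m hp (x := x)
        rw [modelAction_dOp] at h4 ⊢
        rw [modelD_smul, h4, pderivStalk_coord]
        congr 3
        omega
      have h5 : modelAction μ x (dOp x m) (algebraMap ℂ (Module.End ℂ (ℕ →₀ Stalk x)) μ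
          (stalkY μ x 0 0)) = algebraMap ℂ (Stalk x) μ • stalkY μ x 1 (m + 1) := by
        rw [Module.algebraMap_end_apply, map_smul, modelAction_dOp_stalkY μ m (Nat.zero_le _),
          algebraMap_smul_model, zero_add, zero_add]
      rw [Finset.sum_congr rfl fun p _ => h3 p, h5, Finset.sum_add_distrib]
      simp only [ite_smul, one_smul, zero_smul, Finset.sum_ite_eq, Finset.mem_univ, if_true]
      change modelY _ _ (1 + 1) _ + _ = 0
      rw [modelY_of_le _ _ hk]
      push_cast
      simp only [stalkY]
      module
  exact hI h

/-! ### Operators representing the basis vectors, and the kernel of `P ↦ P b_0` -/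

theorem level_le_self (n : ℕ) : level k n ≤ n := by
  rcases level_cases k n with ⟨_, h⟩ | ⟨q, h, h1, _⟩
  · omega
  · have : q ≤ k * q := Nat.le_mul_of_pos_left q (Nat.pos_of_neZero k)
    omega

/-- A word which represents the `n`-th basis vector of the model. -/
def basisWord (k n : ℕ) [NeZero k] : List (Fin k) :=
  (exists_word_of_weight (level k n) n (level_le_self n) (le_mul_level n)).choose

theorem length_basisWord (n : ℕ) : (basisWord k n).length = level k n :=
  (exists_word_of_weight (level k n) n (level_le_self n) (le_mul_level n)).choose_spec.1

theorem weight_basisWord (n : ℕ) : weight (basisWord k n) = n :=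
  (exists_word_of_weight (level k n) n (level_le_self n) (le_mul_level n)).choose_spec.2

/-- The section of `P ↦ P b_0` given by the words which represent the basis vectors. -/
def modelSection (x : Fin k → ℂ) : (ℕ →₀ Stalk x) →ₗ[ℂ] DiffOp x :=
  Finsupp.lsum ℂ fun n => (LinearMap.mulRight ℂ (wordOp x (basisWord k n))).comp
    (mulHom x).toLinearMap

theorem modelSection_single (n : ℕ) (a : Stalk x) :
    modelSection x (Finsupp.single n a) = mulOp a * wordOp x (basisWord k n) := by
  rw [modelSection, Finsupp.lsum_single]
  rfl

theorem modelSection_smul (a : Stalk x) (m : ℕ →₀ Stalk x) :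
    modelSection x (a • m) = mulOp a * modelSection x m := by
  induction m using Finsupp.induction_linear with
  | zero => simp
  | add f g hf hg => rw [smul_add, map_add, map_add, hf, hg, mul_add]
  | single n b =>
    rw [Finsupp.smul_single, modelSection_single, modelSection_single, ← mul_assoc]
    congr 1
    exact map_mul (mulHom x) a b

theorem modelAction_modelSection (m : ℕ →₀ Stalk x) :
    modelAction μ x (modelSection x m) (stalkY μ x 0 0) = m := by
  induction m using Finsupp.induction_linear with
  | zero => simp
  | add f g hf hg => rw [map_add, map_add, LinearMap.add_apply, hf, hg]
  | single n b =>
    rw [modelSection_single, map_mul, Module.End.mul_apply, modelAction_mulOp, modelAction_wordOp,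
      length_basisWord, weight_basisWord, stalkY, modelY_level]
    simp

-- Moving the coefficients of `E` to the left uses `[∂_q, σ_q] = 1` once for each letter, which
-- gives the summand with the length. This is the origin of `mu + q` in the recursion.
omit [NeZero k] in
theorem wordOp_mul_opE (l : List (Fin k)) : wordOp x l * opE x =
    ∑ p, mulOp (coord x p) * wordOp x (p :: l) + (l.length : DiffOp x) * wordOp x l := by
  induction l with
  | nil =>
    have : wordOp x [] = 1 := rfl
    simp only [wordOp_cons, this, List.length_nil, Nat.cast_zero, add_zero, mul_one,
      one_mul]
    rfl
  | cons q l ih =>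
    have h : ∀ p : Fin k, dOp x q * (mulOp (coord x p) * wordOp x (p :: l)) =
        mulOp (coord x p) * wordOp x (p :: q :: l) + if q = p then wordOp x (p :: l) else 0 := by
      intro p
      rw [← mul_assoc, dOp_mul_mulOp, pderivStalk_coord, add_mul, mul_assoc, wordOp_cons,
        wordOp_cons, wordOp_cons, ← mul_assoc (dOp x q), dOp_comm x q p, mul_assoc (dOp x p)]
      congr 1
      split_ifs
      · have : mulOp (1 : Stalk x) = 1 := map_one (mulHom x)
        rw [this, one_mul]
      · have : mulOp (0 : Stalk x) = 0 := map_zero (mulHom x)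
        rw [this, zero_mul]
    rw [wordOp_cons, mul_assoc, ih, mul_add, Finset.mul_sum, Finset.sum_congr rfl fun p _ => h p,
      Finset.sum_add_distrib, Finset.sum_ite_eq, if_pos (Finset.mem_univ q), wordOp_cons,
      List.length_cons, ← mul_assoc (dOp x q), ← Nat.cast_comm, mul_assoc, Nat.cast_add, add_mul,
      Nat.cast_one, one_mul, add_assoc, add_comm (dOp x q * _)]

/-- Modulo `ℐ_μ` the products along words satisfy the recursion which defines the model. -/
theorem wordOp_sub_modelSection_mem (q n : ℕ) (h : n ≤ k * q) (hq : q ≤ n) (l : List (Fin k))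
    (hl : l.length = q) (hw : weight l = n) :
    wordOp x l - modelSection x (stalkY μ x q n) ∈ idealI μ x := by
  have hA : ∀ l l' : List (Fin k), l.length = l'.length → weight l = weight l' →
      wordOp x l - wordOp x l' ∈ idealI μ x :=
    fun l l' h h' => Submodule.mem_sup_left (wordOp_sub_mem x l l' h h')
  have hone : mulOp (1 : Stalk x) = 1 := map_one (mulHom x)
  induction q, n, h using model_induction generalizing l with
  | zero =>
    rw [stalkY, modelY_zero, modelSection_single, hone, one_mul]
    refine hA _ _ ?_ ?_
    · rw [length_basisWord, level_zero, hl]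
    · rw [weight_basisWord, hw]
  | top q n h1 h2 =>
    rw [stalkY, modelY_of_lt _ _ h1, modelSection_single, hone, one_mul]
    refine hA _ _ ?_ ?_
    · rw [length_basisWord, level_eq h1 h2, hl]
    · rw [weight_basisWord, hw]
  | step q n h1 h1' h2 h2' h3 =>
    -- Here `q < n ≤ k q`, so there is a word `γ` of length `q` and weight `n`, and it has a letter
    -- `m` beyond the first. Writing `γ = m β`, the generator attached to `m`, multiplied by `∂^β`,
    -- relates order `q + 1` and weight `n` to heavier words and to `γ`.
    obtain ⟨γ, hγ, hγ'⟩ := exists_word_of_weight q n (by omega) h1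
    obtain ⟨m, β, hp, hm⟩ := exists_perm_cons (l := γ) (by omega)
    have hp1 := weight_perm hp
    have hp2 := hp.length_eq
    rw [weight_cons] at hp1
    rw [List.length_cons] at hp2
    have hmk := m.2
    let m' : Fin k := ⟨m - 1, by omega⟩
    have g1 : wordOp x β * (dOp x 0 * dOp x m' + dOp x m *
        (opE x + algebraMap ℂ (DiffOp x) μ)) ∈ idealI μ x :=
      Submodule.smul_mem _ (wordOp x β) (Submodule.mem_sup_right (Submodule.subset_span
        ⟨m', m, by simp only [m']; omega, rfl⟩))
    have e1 : wordOp x β * (dOp x 0 * dOp x m' + dOp x m *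
        (opE x + algebraMap ℂ (DiffOp x) μ)) = wordOp x (0 :: m' :: β) +
        (∑ p, mulOp (coord x p) * wordOp x (p :: γ) +
          mulOp (algebraMap ℂ (Stalk x) μ + (q : Stalk x)) * wordOp x γ) := by
      have ea : mulOp (algebraMap ℂ (Stalk x) μ + (q : Stalk x)) =
          algebraMap ℂ (DiffOp x) μ + (q : DiffOp x) := by
        have := map_add (mulHom x) (algebraMap ℂ (Stalk x) μ) (q : Stalk x)
        rwa [AlgHom.commutes, map_natCast] at this
      rw [mul_add, ← mul_assoc, ← mul_assoc, ← dOp_mul_wordOp x m, ← wordOp_cons,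
        ← wordOp_perm x hp, mul_add, wordOp_mul_opE, hγ, ea, add_mul, Algebra.commutes,
        ← dOp_mul_wordOp, mul_assoc (dOp x 0), ← dOp_mul_wordOp, wordOp_cons, wordOp_cons]
      abel
    rw [e1] at g1
    have g2 := hA l (0 :: m' :: β) (by simp only [List.length_cons]; omega)
      (by rw [weight_cons, weight_cons]; simp only [m', Fin.val_zero]; omega)
    have g3 : ∑ p, mulOp (coord x p) * (wordOp x (p :: γ) -
        modelSection x (stalkY μ x (q + 1) (n + p + 1))) ∈ idealI μ x :=
      Submodule.sum_mem _ fun p _ => Submodule.smul_mem _ (mulOp (coord x p))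
        (h2' p (by omega) (p :: γ) (by rw [List.length_cons, hγ]) (by rw [weight_cons, hγ']; omega))
    have g4 : mulOp (algebraMap ℂ (Stalk x) μ + (q : Stalk x)) * (wordOp x γ -
        modelSection x (stalkY μ x q n)) ∈ idealI μ x :=
      Submodule.smul_mem _ (mulOp (algebraMap ℂ (Stalk x) μ + (q : Stalk x))) (h3 (by omega) γ hγ hγ')
    have g5 := Submodule.sub_mem _ (Submodule.sub_mem _ (Submodule.add_mem _ g2 g1) g3) g4
    have e2 : modelSection x (stalkY μ x (q + 1) n) =
        -∑ p, mulOp (coord x p) * modelSection x (stalkY μ x (q + 1) (n + p + 1)) -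
          mulOp (algebraMap ℂ (Stalk x) μ + (q : Stalk x)) * modelSection x (stalkY μ x q n) := by
      rw [stalkY, modelY_of_le _ _ h1, map_sub, map_neg, map_sum, modelSection_smul]
      simp only [modelSection_smul]
    have e3 : wordOp x l - modelSection x (stalkY μ x (q + 1) n) =
        (wordOp x l - wordOp x (0 :: m' :: β)) + (wordOp x (0 :: m' :: β) +
        (∑ p, mulOp (coord x p) * wordOp x (p :: γ) +
          mulOp (algebraMap ℂ (Stalk x) μ + (q : Stalk x)) * wordOp x γ)) -
        ∑ p, mulOp (coord x p) * (wordOp x (p :: γ) -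
        modelSection x (stalkY μ x (q + 1) (n + p + 1))) -
        mulOp (algebraMap ℂ (Stalk x) μ + (q : Stalk x)) * (wordOp x γ -
        modelSection x (stalkY μ x q n)) := by
      rw [e2]
      simp only [mul_sub, Finset.sum_sub_distrib]
      abel
    rw [e3]
    exact g5

/-- Shows that `modelSection` inverts `P ↦ P b_0` modulo `ℐ_μ`. With `modelAction_eq_zero` it
follows that the model is `𝒟 / ℐ_μ` and not a proper quotient of it. -/
theorem sub_modelSection_mem (P : DiffOp x) :
    P - modelSection x (modelAction μ x P (stalkY μ x 0 0)) ∈ idealI μ x := by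
  obtain ⟨f, rfl⟩ := normalForm_surjective x P
  induction f using Finsupp.induction_linear with
  | zero => simp
  | add f g hf hg =>
    have := Submodule.add_mem _ hf hg
    rw [map_add, map_add, LinearMap.add_apply, map_add]
    rwa [sub_add_sub_comm] at this
  | single α a =>
    obtain ⟨l, hl⟩ := exists_word α
    have e : normalForm x (Finsupp.single α a) = mulOp a * wordOp x l := by
      rw [normalForm, normalSum_single, hl]; rfl
    rw [e, map_mul, Module.End.mul_apply, modelAction_mulOp, modelAction_wordOp, modelSection_smul,
      ← mul_sub]
    exact Submodule.smul_mem _ (mulOp a) (wordOp_sub_modelSection_mem μ _ _ (weight_le l)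
      (length_le_weight l) l rfl rfl)

/-- The kernel of `P ↦ P b_0` modulo the image of `U_0 - lam` is `𝒥_{μ,lam}`. -/
theorem mem_idealJ_iff (P : DiffOp x) : P ∈ idealJ μ lam x ↔
    ∃ w, modelAction μ x P (stalkY μ x 0 0) = stalkU μ lam x w := by
  constructor
  · intro h
    obtain ⟨P₁, h1, P₂, h2, rfl⟩ := Submodule.mem_sup.mp h
    obtain ⟨Q, rfl⟩ := Submodule.mem_span_singleton.mp h2
    refine ⟨modelAction μ x Q (stalkY μ x 0 0), ?_⟩
    rw [map_add, LinearMap.add_apply, modelAction_eq_zero μ h1, zero_add, smul_eq_mul, map_mul,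
      Module.End.mul_apply, modelAction_opU0, modelAction_stalkU]
  · rintro ⟨w, h⟩
    have h1 : modelAction μ x (modelSection x w * (opU0 x - algebraMap ℂ (DiffOp x) lam))
        (stalkY μ x 0 0) = stalkU μ lam x w := by
      rw [map_mul, Module.End.mul_apply, modelAction_opU0, modelAction_stalkU,
        modelAction_modelSection]
    have h2 := sub_modelSection_mem μ
      (P - modelSection x w * (opU0 x - algebraMap ℂ (DiffOp x) lam))
    rw [map_sub, LinearMap.sub_apply, h, h1, sub_self, map_zero, sub_zero] at h2
    have h3 : modelSection x w * (opU0 x - algebraMap ℂ (DiffOp x) lam) ∈ idealJ μ lam x :=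
      Submodule.mem_sup_right (Submodule.smul_mem _ (modelSection x w)
        (Submodule.mem_span_singleton_self _))
    have := Submodule.add_mem _ (Submodule.mem_sup_left h2 : _ ∈ idealJ μ lam x) h3
    rwa [sub_add_cancel] at this

end Action

/-! ### The connection -/

section Connection

variable {k : ℕ} [NeZero k]

/-- The reduction is carried out over the polynomial ring, so one set of numerators is valid at
every point of `N`. Order `N + 1` needs `N` factors `σ_kΔ` to reach order one. -/
theorem exists_smul_modelY_eq (μ lam : ℂ) (hlam : lam ≠ 0) (N q n : ℕ) (hn : n ≤ k * q)
    (hq : q ≤ N + 1) : ∃ (a : Fin k → MvPolynomial (Fin k) ℂ) (w : ℕ →₀ MvPolynomial (Fin k) ℂ),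
      hypPoly k ^ N • modelY MvPolynomial.X (MvPolynomial.C μ) q n =
        modelE k _ a + modelU MvPolynomial.X (MvPolynomial.C μ) (MvPolynomial.C lam) w := by
  obtain ⟨e, he⟩ := exists_symU_mul_eq (RingHom.id (MvPolynomial (Fin k) ℂ))
  exact exists_smul_eq_of_mem MvPolynomial.X _ _ (hypPoly k) ((Ne.isUnit hlam).map MvPolynomial.C)
    he N (modelF_mono hq (modelY_mem_modelF _ _ hn))

theorem exists_connPoly (μ lam : ℂ) (hlam : lam ≠ 0) (p j : Fin k) :
    ∃ a : Fin k → MvPolynomial (Fin k) ℂ, ∃ w,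
      hypPoly k • modelY MvPolynomial.X (MvPolynomial.C μ) 2 ((j : ℕ) + 1 + p + 1) =
        modelE k _ a + modelU MvPolynomial.X (MvPolynomial.C μ) (MvPolynomial.C lam) w := by
  obtain ⟨a, w, h⟩ := exists_smul_modelY_eq (k := k) μ lam hlam 1 2 ((j : ℕ) + 1 + p + 1)
    (by have := p.2; have := j.2; omega) le_rfl
  rw [pow_one] at h
  exact ⟨a, w, h⟩

/-- The numerators of the connection matrices. -/
def connPoly (k : ℕ) [NeZero k] (μ lam : ℂ) (hlam : lam ≠ 0) (p : Fin k) :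
    Matrix (Fin k) (Fin k) (MvPolynomial (Fin k) ℂ) :=
  fun i j => (exists_connPoly μ lam hlam p j).choose i

variable {x : Fin k → ℂ} {S : Type} [CommRing S] [Algebra (Stalk x) S] (μ lam : ℂ)

/-- `π` is the projection of the model over an extension `S` of `𝒪_{N,x}`. -/
def IsExtProj (μ lam : ℂ) (x : Fin k → ℂ) (S : Type) [CommRing S] [Algebra (Stalk x) S]
    (π : (ℕ →₀ S) →ₗ[S] (Fin k → S)) : Prop :=
  IsModelProj (fun p => algebraMap (Stalk x) S (coord x p))
    (algebraMap (Stalk x) S (algebraMap ℂ _ μ)) (algebraMap (Stalk x) S (algebraMap ℂ _ lam)) π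

/-- Polynomials as elements of an extension of `𝒪_{N,x}`. -/
def polyHom (x : Fin k → ℂ) (S : Type) [CommRing S] [Algebra (Stalk x) S] :
    MvPolynomial (Fin k) ℂ →+* S :=
  (algebraMap (Stalk x) S).comp (MvPolynomial.aeval (coord x)).toRingHom

omit [NeZero k] in
theorem polyHom_apply (f : MvPolynomial (Fin k) ℂ) :
    polyHom x S f = algebraMap (Stalk x) S (germ x fun y => MvPolynomial.eval y f) := by
  rw [germ_eval]; rfl

omit [NeZero k] in
theorem polyHom_X : (fun p => polyHom x S (MvPolynomial.X p)) =
    fun p => algebraMap (Stalk x) S (coord x p) := by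
  funext p
  change algebraMap (Stalk x) S (MvPolynomial.aeval (coord x) (MvPolynomial.X p)) = _
  rw [MvPolynomial.aeval_X]

omit [NeZero k] in
theorem polyHom_C (c : ℂ) :
    polyHom x S (MvPolynomial.C c) = algebraMap (Stalk x) S (algebraMap ℂ _ c) := by
  change algebraMap (Stalk x) S (MvPolynomial.aeval (coord x) (MvPolynomial.C c)) = _
  rw [MvPolynomial.aeval_C]

theorem polyHom_hypPoly : polyHom x S (hypPoly k) = algebraMap (Stalk x) S (germ x hyp) :=
  polyHom_apply _

theorem exists_isExtProj (hlam : lam ≠ 0) (hu : IsUnit (algebraMap (Stalk x) S (germ x hyp))) :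
    ∃ π, IsExtProj μ lam x S π := by
  have h := exists_symU_mul_eq (polyHom x S)
  rw [polyHom_X, polyHom_hypPoly] at h
  obtain ⟨e, he⟩ := h
  exact exists_isModelProj _ _ _ _
    (((Ne.isUnit hlam).map (algebraMap ℂ (Stalk x))).map (algebraMap (Stalk x) S)) hu he

variable {μ lam} {π : (ℕ →₀ S) →ₗ[S] (Fin k → S)}

/-- The classes of the monomials `∂^α` in the model over an extension of `𝒪_{N,x}`. -/
abbrev extY (μ : ℂ) (x : Fin k → ℂ) (S : Type) [CommRing S] [Algebra (Stalk x) S] (q n : ℕ) :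
    ℕ →₀ S :=
  modelY (fun p => algebraMap (Stalk x) S (coord x p))
    (algebraMap (Stalk x) S (algebraMap ℂ _ μ)) q n

theorem IsExtProj.of_relation (hπ : IsExtProj μ lam x S π) {c : MvPolynomial (Fin k) ℂ} {q n : ℕ}
    (hn : n ≤ k * q) {a : Fin k → MvPolynomial (Fin k) ℂ} {w : ℕ →₀ MvPolynomial (Fin k) ℂ}
    (h : c • modelY MvPolynomial.X (MvPolynomial.C μ) q n =
      modelE k _ a + modelU MvPolynomial.X (MvPolynomial.C μ) (MvPolynomial.C lam) w) (i : Fin k) :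
    polyHom x S c * π (extY μ x S q n) i = polyHom x S (a i) := by
  have hπ' : IsModelProj (fun p => polyHom x S (MvPolynomial.X p)) (polyHom x S (MvPolynomial.C μ))
      (polyHom x S (MvPolynomial.C lam)) π := by
    rw [polyHom_X, polyHom_C, polyHom_C]
    exact hπ
  have h1 := congrFun (hπ'.apply_of_relation (polyHom x S) h) i
  rw [modelMap_modelY _ _ _ _ _ hn, polyHom_X, polyHom_C] at h1
  exact h1

/-- The connection matrices as functions. -/
def connFun (k : ℕ) [NeZero k] (μ lam : ℂ) (hlam : lam ≠ 0) (p : Fin k) :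
    Matrix (Fin k) (Fin k) ((Fin k → ℂ) → ℂ) :=
  fun i j y => MvPolynomial.eval y (connPoly k μ lam hlam p i j)

/-- Uniqueness of the decomposition once `σ_kΔ` is invertible: the global polynomial numerators over
`σ_kΔ` give the projection at every point and over every such extension. -/
theorem IsExtProj.connMatrix_eq (hπ : IsExtProj μ lam x S π) (hlam : lam ≠ 0)
    (hu : IsUnit (algebraMap (Stalk x) S (germ x hyp))) (p i j : Fin k) :
    connMatrix (connFun k μ lam hlam) x S p i j = π (extY μ x S 2 ((j : ℕ) + 1 + p + 1)) i := by
  have hn : (j : ℕ) + 1 + p + 1 ≤ k * 2 := by have := p.2; have := j.2; omega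
  obtain ⟨w, hw⟩ := (exists_connPoly μ lam hlam p j).choose_spec
  have h := hπ.of_relation hn hw i
  rw [polyHom_hypPoly, polyHom_apply] at h
  change Ring.inverse _ * algebraMap (Stalk x) S (germ x fun y => _) = _
  rw [← Ring.inverse_mul_cancel_left _ (π (extY μ x S 2 ((j : ℕ) + 1 + p + 1)) i) hu, h]
  rfl

/-! ### Integrability and linearity over the differential operators -/

variable [Algebra ℂ S] [IsScalarTower ℂ (Stalk x) S] {d : Fin k → Derivation ℂ S S}

omit [IsScalarTower ℂ (Stalk x) S] in
theorem IsExtProj.map_modelD (hπ : IsExtProj μ lam x S π) (hlam : lam ≠ 0)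
    (hu : IsUnit (algebraMap (Stalk x) S (germ x hyp)))
    (hd : ∀ p a, d p (algebraMap (Stalk x) S a) = algebraMap (Stalk x) S (pderivStalk x p a))
    (p : Fin k) (m : ℕ →₀ S) :
    π (modelD d (fun p => algebraMap (Stalk x) S (coord x p))
      (algebraMap (Stalk x) S (algebraMap ℂ _ μ)) p m) =
      covDer d (connMatrix (connFun k μ lam hlam) x S) p (π m) := by
  refine IsModelProj.map_modelD hπ d (fun p q => ?_) (fun p => ?_) (fun p => ?_) _
    (fun p i j => hπ.connMatrix_eq hlam hu p i j) p m
  · rw [hd, pderivStalk_coord]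
    split_ifs <;> simp
  · rw [hd, Derivation.map_algebraMap, map_zero]
  · rw [hd, Derivation.map_algebraMap, map_zero]

-- Integrability: the `∇_p` are the images, under the surjective projection, of the commuting
-- derivations of the model.
omit [IsScalarTower ℂ (Stalk x) S] in
theorem covDer_comm (hlam : lam ≠ 0) (hu : IsUnit (algebraMap (Stalk x) S (germ x hyp)))
    (hd : ∀ p a, d p (algebraMap (Stalk x) S a) = algebraMap (Stalk x) S (pderivStalk x p a))
    (hdd : ∀ p q a, d p (d q a) = d q (d p a)) (p q : Fin k) :
    covDer d (connMatrix (connFun k μ lam hlam) x S) p *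
        covDer d (connMatrix (connFun k μ lam hlam) x S) q =
      covDer d (connMatrix (connFun k μ lam hlam) x S) q *
        covDer d (connMatrix (connFun k μ lam hlam) x S) p := by
  obtain ⟨π, hπ⟩ := exists_isExtProj (S := S) μ lam hlam hu
  refine LinearMap.ext fun v => ?_
  obtain ⟨m, rfl⟩ := IsModelProj.surjective hπ v
  rw [Module.End.mul_apply, Module.End.mul_apply, ← hπ.map_modelD hlam hu hd,
    ← hπ.map_modelD hlam hu hd, ← hπ.map_modelD hlam hu hd, ← hπ.map_modelD hlam hu hd,
    ← Module.End.mul_apply, ← Module.End.mul_apply, modelD_comm _ _ _ (fun p q => ?_) (fun p => ?_)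
    hdd]
  · rw [hd, pderivStalk_coord]
    split_ifs <;> simp
  · rw [hd, Derivation.map_algebraMap, map_zero]

omit [NeZero k] in
/-- The action of the differential operators given by an integrable connection. -/
theorem exists_covDer_action
    (hd : ∀ p a, d p (algebraMap (Stalk x) S a) = algebraMap (Stalk x) S (pderivStalk x p a))
    (C : Fin k → Matrix (Fin k) (Fin k) S) (hC : ∀ p q, covDer d C p * covDer d C q =
      covDer d C q * covDer d C p) :
    ∃ ρ : DiffOp x →ₐ[ℂ] Module.End ℂ (Fin k → S),
      (∀ (f : Stalk x) (v : Fin k → S), ρ (mulOp f) v = f • v) ∧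
        ∀ p, ρ (dOp x p) = covDer d C p := by
  obtain ⟨ρ, h, h'⟩ := DiffOp.exists_lift (x := x) (Algebra.lsmul ℂ ℂ (Fin k → S)) (covDer d C) hC
    (fun p a => LinearMap.ext fun v => by
      funext i
      change d p (a • v i) + ∑ j, C p i j * (a • v j) =
        a • (d p (v i) + ∑ j, C p i j * v j) + pderivStalk x p a • v i
      have hs : ∀ b : S, a • b = algebraMap (Stalk x) S a * b := fun b => Algebra.smul_def a b
      rw [Algebra.smul_def (pderivStalk x p a)]
      simp only [hs, Derivation.leibniz, hd, smul_eq_mul, mul_add, Finset.mul_sum,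
        mul_left_comm (algebraMap (Stalk x) S a)]
      ring)
  exact ⟨ρ, fun a m => by rw [h]; rfl, h'⟩

omit [IsScalarTower ℂ (Stalk x) S] in
theorem modelMap_modelD
    (hd : ∀ p a, d p (algebraMap (Stalk x) S a) = algebraMap (Stalk x) S (pderivStalk x p a))
    (p : Fin k) (m : ℕ →₀ Stalk x) :
    modelMap (algebraMap (Stalk x) S)
        (modelD (pderivStalk x) (coord x) (algebraMap ℂ (Stalk x) μ) p m) =
      modelD d (fun p => algebraMap (Stalk x) S (coord x p))
        (algebraMap (Stalk x) S (algebraMap ℂ _ μ)) p (modelMap (algebraMap (Stalk x) S) m) := by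
  induction m using Finsupp.induction_linear with
  | zero => simp
  | add f g hf hg => simp only [map_add, hf, hg]
  | single n a =>
    have hn : n + p + 1 ≤ k * (level k n + 1) := by
      have := le_mul_level (k := k) n
      have := p.2
      rw [mul_add]; omega
    rw [← mul_one a, ← smul_eq_mul, ← Finsupp.smul_single, modelD_smul, modelMap_smul, map_add,
      modelD_smul, modelMap_smul, modelMap_smul, modelMap_single, modelD_single, modelD_single,
      modelMap_modelY _ _ _ _ _ hn, hd]

omit [IsScalarTower ℂ (Stalk x) S] in
theorem IsExtProj.map_action (hπ : IsExtProj μ lam x S π) (hlam : lam ≠ 0)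
    (hu : IsUnit (algebraMap (Stalk x) S (germ x hyp)))
    (hd : ∀ p a, d p (algebraMap (Stalk x) S a) = algebraMap (Stalk x) S (pderivStalk x p a))
    {ρ : DiffOp x →ₐ[ℂ] Module.End ℂ (Fin k → S)}
    (hρ : ∀ (f : Stalk x) (v : Fin k → S), ρ (mulOp f) v = f • v)
    (hρ' : ∀ p, ρ (dOp x p) = covDer d (connMatrix (connFun k μ lam hlam) x S) p)
    (P : DiffOp x) (m : ℕ →₀ Stalk x) :
    π (modelMap (algebraMap (Stalk x) S) (modelAction μ x P m)) =
      ρ P (π (modelMap (algebraMap (Stalk x) S) m)) := by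
  induction P using DiffOp.induction generalizing m with
  | mulOp a =>
    rw [modelAction_mulOp, modelMap_smul, map_smul, hρ, algebraMap_smul]
  | dOp p => rw [modelAction_dOp, modelMap_modelD hd, hπ.map_modelD hlam hu hd, hρ']
  | add Q R hQ hR => simp only [map_add, LinearMap.add_apply, hQ, hR]
  | mul Q R hQ hR => rw [map_mul, map_mul, Module.End.mul_apply, Module.End.mul_apply, hQ, hR]

/-! ### The module `𝒩_{μ,lam}`: maps out of it, torsion and injectivity -/

omit [NeZero k] in
theorem ModN.mk_surjective [NeZero k] (μ lam : ℂ) (x : Fin k → ℂ) :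
    Function.Surjective (ModN.mk μ lam x) :=
  Submodule.mkQ_surjective _

theorem ModN.mk_eq_zero_iff {P : DiffOp x} : ModN.mk μ lam x P = 0 ↔ P ∈ idealJ μ lam x :=
  Submodule.Quotient.mk_eq_zero _

theorem ModN.exists_lift {A : Type} [AddCommGroup A] (f : DiffOp x →+ A)
    (h : ∀ P ∈ idealJ μ lam x, f P = 0) :
    ∃ φ : ModN μ lam x →+ A, ∀ P, φ (ModN.mk μ lam x P) = f P :=
  ⟨(QuotientAddGroup.lift (idealJ μ lam x).toAddSubgroup f h :
    DiffOp x ⧸ (idealJ μ lam x).toAddSubgroup →+ A), fun _ => rfl⟩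

omit [Algebra ℂ S] [IsScalarTower ℂ (Stalk x) S] in
/-- The map from `𝒩_{μ,lam}` to the fibres `S^k` given by the projection. -/
theorem IsExtProj.exists_hom (hπ : IsExtProj μ lam x S π) :
    ∃ φ : ModN μ lam x →+ (Fin k → S), ∀ P, φ (ModN.mk μ lam x P) =
      π (modelMap (algebraMap (Stalk x) S) (modelAction μ x P (stalkY μ x 0 0))) := by
  refine ModN.exists_lift (A := Fin k → S)
    (π.toAddMonoidHom.comp ((modelMap (algebraMap (Stalk x) S)).comp
      ((modelAction μ x).toLinearMap.flip (stalkY μ x 0 0)).toAddMonoidHom)) fun P hP => ?_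
  obtain ⟨w, hw⟩ := (mem_idealJ_iff μ lam P).mp hP
  change π (modelMap (algebraMap (Stalk x) S) (modelAction μ x P (stalkY μ x 0 0))) = 0
  rw [hw, modelMap_modelU]
  exact IsModelProj.modelU hπ _

omit [NeZero k] in
theorem isUnit_natCast_sub (hlam : ∀ n : ℕ, lam ≠ n) (n : ℕ) :
    IsUnit ((n : Stalk x) - algebraMap ℂ (Stalk x) lam) := by
  rw [← map_natCast (algebraMap ℂ (Stalk x)), ← map_sub]
  exact (Ne.isUnit (sub_ne_zero.mpr (hlam n).symm)).map _

/-- `𝒩_{μ,lam}` has no torsion. -/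
theorem ModN.eq_zero_of_mulOp_smul (hlam : ∀ n : ℕ, lam ≠ n) {f : Stalk x} (hf : f ≠ 0)
    {n : ModN μ lam x} (h : mulOp f • n = 0) : n = 0 := by
  obtain ⟨P, rfl⟩ := ModN.mk_surjective μ lam x n
  rw [← map_smul, ModN.mk_eq_zero_iff, mem_idealJ_iff] at h
  obtain ⟨w, hw⟩ := h
  rw [smul_eq_mul, map_mul, Module.End.mul_apply, modelAction_mulOp] at hw
  rw [ModN.mk_eq_zero_iff, mem_idealJ_iff]
  exact modelU_torsionFree _ _ _ (isUnit_natCast_sub hlam) (mem_nonZeroDivisors_of_ne_zero hf) hw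

omit [Algebra ℂ S] [IsScalarTower ℂ (Stalk x) S] in
/-- If every element of `S` is a fraction with a power of `σ_kΔ` as denominator, the map from
`𝒩_{μ,lam}` to `S^k` is injective. -/
theorem IsExtProj.hom_injective (hπ : IsExtProj μ lam x S π) (hlam : ∀ n : ℕ, lam ≠ n)
    (hinj : Function.Injective (algebraMap (Stalk x) S))
    (hfrac : ∀ a : S, ∃ (N : ℕ) (b : Stalk x), algebraMap (Stalk x) S (germ x hyp) ^ N * a =
      algebraMap (Stalk x) S b)
    {φ : ModN μ lam x →+ (Fin k → S)} (hφ : ∀ P, φ (ModN.mk μ lam x P) =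
      π (modelMap (algebraMap (Stalk x) S) (modelAction μ x P (stalkY μ x 0 0)))) :
    Function.Injective φ := by
  have hfrac' : ∀ w : ℕ →₀ S, ∃ (N : ℕ) (v : ℕ →₀ Stalk x),
      algebraMap (Stalk x) S (germ x hyp) ^ N • w = modelMap (algebraMap (Stalk x) S) v := by
    intro w
    induction w using Finsupp.induction_linear with
    | zero => exact ⟨0, 0, by simp⟩
    | add f g hf hg =>
      obtain ⟨N, v, h⟩ := hf
      obtain ⟨N', v', h'⟩ := hg
      refine ⟨N + N', germ x hyp ^ N' • v + germ x hyp ^ N • v', ?_⟩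
      rw [map_add, modelMap_smul, modelMap_smul, ← h, ← h', map_pow, map_pow, smul_smul, smul_smul,
        ← pow_add, ← pow_add, smul_add, add_comm N' N]
    | single n a =>
      obtain ⟨N, b, h⟩ := hfrac a
      refine ⟨N, Finsupp.single n b, ?_⟩
      rw [Finsupp.smul_single, smul_eq_mul, h]
      simp [modelMap]
  refine (injective_iff_map_eq_zero φ).mpr fun n hn => ?_
  obtain ⟨P, rfl⟩ := ModN.mk_surjective μ lam x n
  rw [hφ] at hn
  obtain ⟨w, hw⟩ := (IsModelProj.eq_zero_iff hπ _).mp hn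
  -- The preimage `w` under `U_0 - lam` may have denominators. Clearing them puts `(σ_kΔ)^N P` into
  -- `𝒥_{μ,lam}`, and torsion-freeness removes the factor.
  obtain ⟨N, v, hv⟩ := hfrac' w
  refine ModN.eq_zero_of_mulOp_smul hlam (pow_ne_zero N (germ_hyp_ne_zero x)) ?_
  rw [← map_smul, ModN.mk_eq_zero_iff, mem_idealJ_iff, smul_eq_mul, map_mul, Module.End.mul_apply,
    modelAction_mulOp]
  refine ⟨v, ?_⟩
  have h1 : modelMap (algebraMap (Stalk x) S)
      (germ x hyp ^ N • modelAction μ x P (stalkY μ x 0 0)) =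
      modelMap (algebraMap (Stalk x) S) (stalkU μ lam x v) := by
    rw [modelMap_smul, hw, map_pow, ← map_smul, hv, modelMap_modelU]
  ext i
  exact hinj (DFunLike.congr_fun h1 i)

end Connection

/-! ### The morphism of sheaves -/

section Sheaf

variable {k : ℕ} [NeZero k]

instance (x : Fin k → ℂ) : IsScalarTower ℂ (Stalk x) (Mero x) :=
  inferInstanceAs (IsScalarTower ℂ (Stalk x) (Localization.Away (germ x (hyp (k := k)))))

theorem isUnit_hyp_mero (x : Fin k → ℂ) :
    IsUnit (algebraMap (Stalk x) (Mero x) (germ x hyp)) :=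
  IsLocalization.Away.algebraMap_isUnit (S := Localization.Away (germ x (hyp (k := k))))
    (germ x hyp)

theorem mero_fraction (x : Fin k → ℂ) (a : Mero x) : ∃ (N : ℕ) (b : Stalk x),
    algebraMap (Stalk x) (Mero x) (germ x hyp) ^ N * a = algebraMap (Stalk x) (Mero x) b := by
  obtain ⟨N, b, h⟩ := IsLocalization.Away.surj (S := Localization.Away (germ x (hyp (k := k))))
    (germ x hyp) a
  exact ⟨N, b, (mul_comm _ _).trans h⟩

theorem mero_injective (x : Fin k → ℂ) : Function.Injective (algebraMap (Stalk x) (Mero x)) := by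
  have h : Function.Injective (algebraMap (Stalk x) (Localization.Away (germ x (hyp (k := k))))) :=
    IsLocalization.injective _
      (powers_le_nonZeroDivisors_of_noZeroDivisors (germ_hyp_ne_zero x))
  exact h

theorem pderivMero_algebraMap (x : Fin k → ℂ) (p : Fin k) (a : Stalk x) :
    pderivMero x p (algebraMap (Stalk x) (Mero x) a) =
      algebraMap (Stalk x) (Mero x) (pderivStalk x p a) :=
  awayDerivation_algebraMap _ _ _

/-- The commutator is a derivation that vanishes on `𝒪`; applied to `(σ_kΔ)^N a`, which comes from
`𝒪`, it vanishes on `a` as well. -/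
theorem pderivMero_comm (x : Fin k → ℂ) (p q : Fin k) (a : Mero x) :
    pderivMero x p (pderivMero x q a) = pderivMero x q (pderivMero x p a) := by
  rw [← sub_eq_zero, ← Derivation.commutator_apply]
  obtain ⟨N, b, h⟩ := mero_fraction x a
  have h0 : ∀ b, ⁅pderivMero x p, pderivMero x q⁆ (algebraMap (Stalk x) (Mero x) b) = 0 := by
    intro b
    rw [Derivation.commutator_apply]
    simp only [pderivMero_algebraMap, pderivStalk_comm x p q, sub_self]
  have h1 := h0 b
  rw [← h, Derivation.leibniz, ← map_pow, h0, smul_zero, add_zero, smul_eq_mul, map_pow] at h1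
  exact (((isUnit_hyp_mero x).pow N).mul_right_eq_zero).mp h1

/-- The connection `∇_{μ,lam}`. -/
def traceConnection (k : ℕ) [NeZero k] (μ lam : ℂ) (hlam : lam ≠ 0) : SimplePoleConnection k where
  B := connFun k μ lam hlam
  holomorphic _ _ _ := fun y _ => analyticAt_eval _ y
  integrable x p q := covDer_comm hlam (isUnit_hyp_mero x) (pderivMero_algebraMap x)
    (pderivMero_comm x) p q

omit [NeZero k] in
theorem germ_sum_mul {ι : Type} (s : Finset ι) (a b : ι → (Fin k → ℂ) → ℂ) (y : Fin k → ℂ)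
    (ha : ∀ i ∈ s, AnalyticAt ℂ (a i) y) (hb : ∀ i ∈ s, AnalyticAt ℂ (b i) y) :
    AnalyticAt ℂ (∑ i ∈ s, a i * b i) y ∧
      germ y (∑ i ∈ s, a i * b i) = ∑ i ∈ s, germ y (a i) * germ y (b i) := by
  classical
  induction s using Finset.induction_on with
  | empty => exact ⟨analyticAt_const, (germ_of_mem (x := y) 0).trans (map_zero _)⟩
  | insert i s hi ih =>
    obtain ⟨h1, h2⟩ := ih (fun j hj => ha j (Finset.mem_insert_of_mem hj))
      (fun j hj => hb j (Finset.mem_insert_of_mem hj))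
    have ha' := ha i (Finset.mem_insert_self i s)
    have hb' := hb i (Finset.mem_insert_self i s)
    rw [Finset.sum_insert hi, Finset.sum_insert hi]
    exact ⟨(ha'.mul hb').add h1, by rw [germ_add (ha'.mul hb') h1, germ_mul ha' hb', h2]⟩

theorem isSectionMero_of_isSectionN {μ lam : ℂ} (hlam : lam ≠ 0)
    {π : ∀ x : Fin k → ℂ, (ℕ →₀ Mero x) →ₗ[Mero x] (Fin k → Mero x)}
    (hπ : ∀ x, IsExtProj μ lam x (Mero x) (π x))
    {φ : ∀ x : Fin k → ℂ, ModN μ lam x →+ (Fin k → Mero x)}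
    (hφ : ∀ x P, φ x (ModN.mk μ lam x P) =
      π x (modelMap (algebraMap (Stalk x) (Mero x)) (modelAction μ x P (stalkY μ x 0 0))))
    {V : Set (Fin k → ℂ)} {n : ∀ y : Fin k → ℂ, ModN μ lam y} (hn : IsSectionN μ lam V n) :
    IsSectionMero V fun y => φ y (n y) := by
  intro x hx
  obtain ⟨W, P, hW, hxW, hP, hnP⟩ := hn x hx
  obtain ⟨s, a, ha, hPa⟩ := hP x hxW
  choose l hl using fun α : Fin k → ℕ => exists_word α
  -- A section of `𝒟` has locally bounded order, so a single power of `σ_kΔ` clears the denominators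
  -- near `x`. The numerators are then the coefficients `a α` times global polynomials.
  let N := s.sup fun α => (l α).length
  have hrel : ∀ α, ∃ (c : Fin k → MvPolynomial (Fin k) ℂ) (w : ℕ →₀ MvPolynomial (Fin k) ℂ),
      α ∈ s → hypPoly k ^ N • modelY MvPolynomial.X (MvPolynomial.C μ) (l α).length (weight (l α)) =
        modelE k _ c + modelU MvPolynomial.X (MvPolynomial.C μ) (MvPolynomial.C lam) w := by
    intro α
    by_cases hα : α ∈ s
    · obtain ⟨c, w, h⟩ := exists_smul_modelY_eq μ lam hlam N (l α).length (weight (l α))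
        (weight_le _) (by
          have : (l α).length ≤ N := Finset.le_sup (f := fun α => (l α).length) hα
          omega)
      exact ⟨c, w, fun _ => h⟩
    · exact ⟨0, 0, fun h => absurd h hα⟩
  choose c w hcw using hrel
  have hc : ∀ i α y, AnalyticAt ℂ (fun y => MvPolynomial.eval y (c α i)) y :=
    fun i α y => analyticAt_eval _ y
  refine ⟨N, fun i => ∑ α ∈ s, a α * fun y => MvPolynomial.eval y (c α i),
    fun i => (germ_sum_mul s a _ x ha fun α _ => hc i α x).1, ?_⟩
  have han : ∀ᶠ y in 𝓝 x, ∀ α ∈ s, AnalyticAt ℂ (a α) y :=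
    (Filter.eventually_all_finset s).mpr fun α hα => (ha α hα).eventually_analyticAt
  filter_upwards [han, hPa, hW.mem_nhds hxW] with y hy hPy hyW i
  rw [(germ_sum_mul s a _ y hy fun α _ => hc i α y).2, map_sum]
  rw [hnP y hyW, hφ, hPy]
  simp only [map_sum, LinearMap.sum_apply, Finset.sum_apply, Finset.smul_sum]
  refine Finset.sum_congr rfl fun α hα => ?_
  have e : dMonomial y α = wordOp y (l α) := hl α _ (dOp y)
  rw [e, map_mul, Module.End.mul_apply, modelAction_mulOp, modelAction_wordOp, modelMap_smul,
    modelMap_modelY _ _ _ _ _ (weight_le _), map_smul, Pi.smul_apply, smul_eq_mul, map_mul,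
    Algebra.smul_def, mul_left_comm]
  congr 1
  have h := (hπ y).of_relation (weight_le _) (hcw α hα) i
  rw [map_pow, polyHom_hypPoly, polyHom_apply] at h
  rw [map_pow]
  exact h

end Sheaf

end TraceSystem

end

/-! ### Assembly of the theorem -/

theorem corollary3p2p5 (k : ℕ) [NeZero k] (μ lam : ℂ) (hlam : ∀ n : ℕ, lam ≠ (n : ℂ)) :
    (∃ (conn : TraceSystem.SimplePoleConnection k)
        (ρ : ∀ x : Fin k → ℂ,
          TraceSystem.DiffOp x →ₐ[ℂ] Module.End ℂ (Fin k → TraceSystem.Mero x))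
        (φ : ∀ x : Fin k → ℂ,
          TraceSystem.ModN μ lam x →+ (Fin k → TraceSystem.Mero x)),
      (∀ x, conn.IsActionMero x (ρ x)) ∧
      TraceSystem.IsSheafMorphism μ lam ρ φ ∧
      (∀ x, Function.Injective (φ x)) ∧
      ∀ x : Fin k → ℂ, TraceSystem.hyp x ≠ 0 →
        ∃ (ρU : TraceSystem.DiffOp x →ₐ[ℂ] Module.End ℂ (Fin k → TraceSystem.Stalk x))
          (ψ : TraceSystem.ModN μ lam x ≃+ (Fin k → TraceSystem.Stalk x)),
          conn.IsActionHol x ρU ∧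
          (∀ (P : TraceSystem.DiffOp x) (n : TraceSystem.ModN μ lam x),
            ψ (P • n) = ρU P (ψ n)) ∧
          ∀ (n : TraceSystem.ModN μ lam x) (i : Fin k),
            φ x n i = algebraMap (TraceSystem.Stalk x) (TraceSystem.Mero x) (ψ n i)) ∧
    ∀ (x : Fin k → ℂ) (f : TraceSystem.Stalk x) (n : TraceSystem.ModN μ lam x),
      f ≠ 0 → TraceSystem.mulOp f • n = 0 → n = 0 := by
  open TraceSystem in
  have h0 : lam ≠ 0 := by simpa using hlam 0
  refine ⟨?_, fun x f n hf h => ModN.eq_zero_of_mulOp_smul hlam hf h⟩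
  choose π hπ using fun x : Fin k → ℂ => exists_isExtProj (S := Mero x) μ lam h0 (isUnit_hyp_mero x)
  choose φ hφ using fun x => (hπ x).exists_hom
  choose ρ hρ hρ' using fun x : Fin k → ℂ => exists_covDer_action (pderivMero_algebraMap x)
    (connMatrix (connFun k μ lam h0) x (Mero x)) fun p q => covDer_comm h0 (isUnit_hyp_mero x)
      (pderivMero_algebraMap x) (pderivMero_comm x) p q
  refine ⟨traceConnection k μ lam h0, ρ, φ, fun x => ⟨hρ x, hρ' x⟩,
    ⟨fun x P n => ?_, fun V n _ hn => isSectionMero_of_isSectionN h0 hπ hφ hn⟩,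
    fun x => (hπ x).hom_injective hlam (mero_injective x) (mero_fraction x) (hφ x), ?_⟩
  · obtain ⟨Q, rfl⟩ := ModN.mk_surjective μ lam x n
    rw [← map_smul, hφ, hφ, smul_eq_mul, map_mul, Module.End.mul_apply]
    exact (hπ x).map_action h0 (isUnit_hyp_mero x) (pderivMero_algebraMap x) (hρ x) (hρ' x) P _
  intro x hx
  have hu : IsUnit (algebraMap (Stalk x) (Stalk x) (germ x hyp)) :=
    isUnit_germ (f := hyp) (analyticAt_eval _ x) hx
  have hd : ∀ p a, pderivStalk x p (algebraMap (Stalk x) (Stalk x) a) =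
    algebraMap (Stalk x) (Stalk x) (pderivStalk x p a) := fun _ _ => rfl
  -- Off the hypersurface `σ_kΔ` is a unit of `𝒪` itself, so the same construction works without
  -- localizing.
  obtain ⟨πU, hπU⟩ := exists_isExtProj (S := Stalk x) μ lam h0 hu
  obtain ⟨ψ, hψ⟩ := hπU.exists_hom
  obtain ⟨ρU, hρU, hρU'⟩ := exists_covDer_action hd (connMatrix (connFun k μ lam h0) x (Stalk x))
    fun p q => covDer_comm h0 hu hd (pderivStalk_comm x) p q
  have hid : ∀ m : ℕ →₀ Stalk x, modelMap (algebraMap (Stalk x) (Stalk x)) m = m :=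
    fun m => Finsupp.ext fun i => rfl
  have hbij : Function.Bijective ψ := by
    refine ⟨hπU.hom_injective hlam (fun a b h => h) (fun a => ⟨0, a, ?_⟩) hψ, fun v => ?_⟩
    · rw [pow_zero, one_mul]; rfl
    · obtain ⟨m, rfl⟩ := IsModelProj.surjective hπU v
      -- Surjectivity: every vector of the model is `P b_0` for an operator `P`, and the projection
      -- is onto.
      exact ⟨ModN.mk μ lam x (modelSection x m), by
        rw [hψ, modelAction_modelSection, hid]⟩
  refine ⟨ρU, AddEquiv.ofBijective ψ hbij, ⟨hρU, hρU'⟩, fun P n => ?_, fun n i => ?_⟩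
  · obtain ⟨Q, rfl⟩ := ModN.mk_surjective μ lam x n
    rw [AddEquiv.ofBijective_apply, AddEquiv.ofBijective_apply, ← map_smul, hψ, hψ, smul_eq_mul,
      map_mul, Module.End.mul_apply]
    exact hπU.map_action h0 hu hd hρU hρU' P _
  · obtain ⟨Q, rfl⟩ := ModN.mk_surjective μ lam x n
    rw [AddEquiv.ofBijective_apply, hψ, hφ, hid]
    -- Decompositions over `𝒪` map to decompositions over `𝒪(*σ_kΔ)`, so by uniqueness the two
    -- projections agree.
    exact IsModelProj.map_modelMap (algebraMap (Stalk x) (Mero x)) hπU (hπ x) _ i
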